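/- Strings are finite binary strings, $|s|$ is the length of $s$. A *prefix-free machine* is a partial recursive function $C$ from strings to strings such that no string in its domain is a prefix of another string in its domain, and $H_C(s)=\min\{|p| : C(p)=s\}$ (which is $\infty$ if there is no such $p$). A prefix-free machine $U$ is *optimal* if for every prefix-free machine $C$ there is $d\in\mathbb{N}$ such that for every $p\in\operatorname{dom} C$ there is $q\in\operatorname{dom} U$ with $U(q)=C(p)$ and $|q|\le|p|+d$. Fix an optimal prefix-free machine $U$ and write $H=H_U$. For a real $\alpha$ and $n\ge 1$, let $\alpha\restriction_n$ be the first $n$ bits of the base-two expansion of $\alpha-\lfloor\alpha\rfloor$ with infinitely many zeros. A real $\alpha$ is *right-computable* if there is a total recursive $f:\mathbb{N}^+\to\mathbb{Q}$ with $\alpha\le f(n)$ for all $n$ and $\lim_{n\to\infty} f(n)=\alpha$; it is *left-computable* if $-\alpha$ is right-computable; it is *computable* if there is a total recursive $f:\mathbb{N}^+\to\mathbb{Q}$ with $|\alpha-f(n)|<1/n$ for all $n$. For $T\in(0,1]$, $\alpha$ is *weakly Chaitin $T$-random* if there is $c\in\mathbb{N}$ with $Tn-c\le H(\alpha\restriction_n)$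 for all $n\ge 1$, and *strictly $T$-compressible* if there is $d\in\mathbb{N}$ with $H(\alpha\restriction_n)\le Tn+d$ for all $n\ge 1$. **Theorem.** Let $V$ be an optimal prefix-free machine, let $T>0$ be real, and let $$\overline{\mathrm{CS}}_V(T)=\sum_{s:\ H_V(s)<T|s|}2^{-|s|},$$ where the sum is over all strings $s$ with $H_V(s)<T|s|$. 1. If $T$ is left-computable and $0<T\le 1$, then the series converges, and $\overline{\mathrm{CS}}_V(T)$ is a left-computable real which is weakly Chaitin $T$-random. 2. If $T$ is computable and $0<T<1$, then the series converges, and $\overline{\mathrm{CS}}_V(T)$ is strictly $T$-compressible. 3. If $T>1$, then $\overline{\mathrm{CS}}_V(T)$ diverges to $\infty$. -/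

import Mathlib

open scoped ENNReal

/-! ### Computability of reals -/

/-- A total recursive sequence of rationals: it is the quotient of a recursive sequence of integers
by a recursive sequence of nonzero natural numbers. -/
def IsRecursiveRatSeq (f : ℕ → ℚ) : Prop :=
  ∃ (a : ℕ → ℤ) (b : ℕ → ℕ), Computable a ∧ Computable b ∧
    ∀ n, b n ≠ 0 ∧ f n = (a n : ℚ) / (b n : ℚ)

/-- `α` is right-computable: it is the limit of a recursive sequence of rational upper bounds,
indexed by the positive integers (the value at `0` plays no role). -/
def IsRightComputable (α : ℝ) : Prop :=
  ∃ f : ℕ → ℚ, IsRecursiveRatSeq f ∧ (∀ n, 1 ≤ n → α ≤ (f n : ℝ)) ∧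
    Filter.Tendsto (fun n => (f n : ℝ)) Filter.atTop (nhds α)

/-- `α` is left-computable if `-α` is right-computable. -/
def IsLeftComputable (α : ℝ) : Prop :=
  IsRightComputable (-α)

/-- `α` is computable: a recursive sequence of rationals, indexed by the positive integers,
approximates it with error less than `1 / n`. -/
def IsComputableReal (α : ℝ) : Prop :=
  ∃ f : ℕ → ℚ, IsRecursiveRatSeq f ∧ ∀ n : ℕ, 1 ≤ n → |α - (f n : ℝ)| < 1 / (n : ℝ)

/-! ### Prefix-free machines and program-size complexity -/

/-- Finite binary strings. -/
abbrev BinString := List Bool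

/-- No string in `S` is a prefix of another string in `S`. -/
def IsPrefixFreeSet (S : Set BinString) : Prop :=
  ∀ p ∈ S, ∀ q ∈ S, p <+: q → p = q

/-- A prefix-free machine: a partial recursive function on binary strings with prefix-free domain
of definition. -/
def IsPrefixFreeMachine (C : BinString →. BinString) : Prop :=
  Partrec C ∧ IsPrefixFreeSet C.Dom

/-- An optimal prefix-free machine: it simulates every prefix-free machine with a constant
overhead in the length of the programs. -/
def IsOptimalMachine (U : BinString →. BinString) : Prop :=
  IsPrefixFreeMachine U ∧
    ∀ C : BinString →. BinString, IsPrefixFreeMachine C →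
      ∃ d : ℕ, ∀ p ∈ C.Dom, ∃ q ∈ U.Dom, U q = C p ∧ q.length ≤ p.length + d

/-- Program-size complexity `H_C(s)`: the least length of a program `p` with `C(p) = s`, and `⊤` if
there is none. -/
noncomputable def programSize (C : BinString →. BinString) (s : BinString) : ℕ∞ :=
  ⨅ p ∈ {p : BinString | s ∈ C p}, (p.length : ℕ∞)

/-- Program-size complexity as an extended real, to be compared with reals. -/
noncomputable def programSizeE (C : BinString →. BinString) (s : BinString) : EReal :=
  ((programSize C s : ℝ≥0∞) : EReal)

/-! ### Partial randomness -/

/-- The first `n` bits of the base-two expansion of the fractional part of `α` with infinitely many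
zeros: the bit of weight `2 ^ (-(i + 1))` is the parity of `⌊2 ^ (i + 1) * (α - ⌊α⌋)⌋`. -/
noncomputable def binPrefix (α : ℝ) (n : ℕ) : BinString :=
  (List.range n).map fun i => decide (⌊(2 : ℝ) ^ (i + 1) * Int.fract α⌋ % 2 = 1)

/-- Weak Chaitin `T`-randomness of `α`, complexity being measured by the machine `U`. -/
def IsWeaklyChaitinRandom (U : BinString →. BinString) (T α : ℝ) : Prop :=
  ∃ c : ℕ, ∀ n : ℕ, 1 ≤ n →
    ((T * (n : ℝ) - (c : ℝ) : ℝ) : EReal) ≤ programSizeE U (binPrefix α n)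

/-- Strict `T`-compressibility of `α`, complexity being measured by the machine `U`. -/
def IsStrictlyCompressible (U : BinString →. BinString) (T α : ℝ) : Prop :=
  ∃ d : ℕ, ∀ n : ℕ, 1 ≤ n →
    programSizeE U (binPrefix α n) ≤ ((T * (n : ℝ) + (d : ℝ) : ℝ) : EReal)

/-- The sum of `2 ^ (-|s|)` over all binary strings `s` with `H_V(s) < T * |s|`, as an extended
nonnegative real; it is `⊤` exactly if the series diverges. -/
noncomputable def compressibleSum (V : BinString →. BinString) (T : ℝ) : ℝ≥0∞ :=
  ∑' s : {s : BinString // programSizeE V s < ((T * (s.length : ℝ) : ℝ) : EReal)},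
    (2 : ℝ≥0∞)⁻¹ ^ s.1.length

/-! Write `α` for the sum. Every string `s` counted in it has a program shorter than `T|s|`, and
distinct strings have distinct programs, so Kraft's inequality controls sums over such `s`. For `T ≤
1` the program is at least one bit shorter than `s`, whence `α ≤ 1/2` (`compressibleSum_le_half`);
in particular every length has a string that is not counted.

Randomness: the first `n` bits of `α` lead to a stage of the enumeration at which less than `2 ^ (1
- n)` of the sum is missing. Every string of length `n - 1` that is ever counted has then appeared.
A string `s` of that length which has not appeared satisfies `T(n - 1) ≤ H_V(s)`, but it is computed
from those `n` bits, so `H_V(s)` exceeds their `H_U` by at most a constant.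

Compressibility: by the Kraft–Chaitin theorem (`exists_machine_of_requests`) it suffices to request
descriptions of length about `Tn` for the `n`-bit truncations of all partial sums, at finite total
weight. At precision `n` there are at most `1 + ∑_s 2 ^ (-max(|s| - n, 0))` truncations
(`card_image_natFloor_le`). Weighting by `2 ^ (-Tn)` and exchanging the sums leaves, for each `s`,
two geometric series leaving `n = |s|` with ratios `2 ^ (-T)` and `2 ^ (T - 1)`. The total is of
order `∑_s 2 ^ (-T|s|)`, which Kraft's inequality bounds.

Divergence: requests of length about `(1 + 1/m)|s|` for all `s` have finite weight, so for `T > 1`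
all long strings are counted, and each length contributes `1`. -/

/-! ### Computability of elementary functions -/

theorem primrec_nat_pow : Primrec₂ ((· ^ ·) : ℕ → ℕ → ℕ) :=
  Primrec₂.unpaired'.1 Nat.Primrec.pow

/-- Integers are encoded with `k` at `2 * k` and `-(k + 1)` at `2 * k + 1`; the parity tests here
and below read off the sign. -/
theorem primrec_int_toNat : Primrec Int.toNat := by
  refine Primrec.ofNat_iff.2 ?_
  have h : Primrec fun n : ℕ => if n % 2 = 0 then n / 2 else 0 :=
    Primrec.ite (Primrec.eq.comp (Primrec.nat_mod.comp Primrec.id (Primrec.const 2))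
      (Primrec.const 0)) (Primrec.nat_div.comp Primrec.id (Primrec.const 2)) (Primrec.const 0)
  refine h.of_eq fun n => ?_
  obtain ⟨z, rfl⟩ : ∃ z : ℤ, n = Encodable.encode z := ⟨Denumerable.ofNat ℤ n, (Denumerable.encode_ofNat n).symm⟩
  rw [Denumerable.ofNat_encode]
  obtain k | k := z
  · change (if (2 * k) % 2 = 0 then (2 * k) / 2 else 0) = k
    simp
  · change (if (2 * k + 1) % 2 = 0 then (2 * k + 1) / 2 else 0) = 0
    rw [if_neg (by omega)]

theorem primrec_neg_natCast : Primrec fun k : ℕ => -(k : ℤ) := by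
  rw [← Primrec.encode_iff]
  have h : Primrec fun k : ℕ => 2 * k - 1 :=
    Primrec.nat_sub.comp Primrec.nat_double (Primrec.const 1)
  refine h.of_eq fun k => ?_
  obtain _ | k := k
  · rfl
  · change 2 * (k + 1) - 1 = 2 * k + 1
    omega

theorem primrec_int_neg : Primrec fun z : ℤ => -z := by
  refine Primrec.ofNat_iff.2 (Primrec.encode_iff.1 ?_)
  have h : Primrec fun n : ℕ => if n % 2 = 0 then n - 1 else n + 1 :=
    Primrec.ite (Primrec.eq.comp (Primrec.nat_mod.comp Primrec.id (Primrec.const 2))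
      (Primrec.const 0)) (Primrec.nat_sub.comp Primrec.id (Primrec.const 1)) Primrec.succ
  refine h.of_eq fun n => ?_
  obtain ⟨z, rfl⟩ : ∃ z : ℤ, n = Encodable.encode z := ⟨Denumerable.ofNat ℤ n, (Denumerable.encode_ofNat n).symm⟩
  rw [Denumerable.ofNat_encode]
  obtain k | k := z
  · obtain _ | k := k
    · rfl
    · change (if (2 * (k + 1)) % 2 = 0 then (2 * (k + 1)) - 1 else _) = 2 * k + 1
      rw [if_pos (by omega)]
      omega
  · change (if (2 * k + 1) % 2 = 0 then _ else (2 * k + 1) + 1) = 2 * (k + 1)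
    rw [if_neg (by omega)]
    omega

theorem primrecRel_mem_list {β : Type*} [Primcodable β] :
    PrimrecRel fun (b : β) (l : List β) => b ∈ l :=
  ((PrimrecRel.exists_mem_list (R := fun a b : β => a = b) Primrec.eq).comp
    (Primrec.snd (α := β) (β := List β)) Primrec.fst).of_eq fun p => by simp

/-- Dovetailing: `i` codes a step bound together with an input. -/
theorem exists_computable_graph {α σ : Type*} [Primcodable α] [Primcodable σ] {f : α →. σ}
    (hf : Partrec f) :
    ∃ h : ℕ → Option (α × σ), Computable h ∧ ∀ a b, b ∈ f a ↔ ∃ i, h i = some (a, b) := by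
  obtain ⟨c, hc⟩ := Nat.Partrec.Code.exists_code.1 hf
  refine ⟨fun i => (Encodable.decode (α := α) i.unpair.2).bind fun a =>
    (Nat.Partrec.Code.evaln i.unpair.1 c (Encodable.encode a)).bind fun m =>
      (Encodable.decode (α := σ) m).map fun b => (a, b), ?_, ?_⟩
  · have h1 : Primrec fun i : ℕ => Encodable.decode (α := α) i.unpair.2 :=
      Primrec.decode.comp (Primrec.snd.comp Primrec.unpair)
    have h2 : Primrec₂ fun (i : ℕ) (a : α) =>
        Nat.Partrec.Code.evaln i.unpair.1 c (Encodable.encode a) :=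
      Nat.Partrec.Code.primrec_evaln.comp (Primrec.pair (Primrec.pair
        (Primrec.fst.comp (Primrec.unpair.comp Primrec.fst)) (Primrec.const c))
        (Primrec.encode.comp Primrec.snd))
    have h3 : Primrec₂ fun (x : ℕ × α) (m : ℕ) =>
        (Encodable.decode (α := σ) m).map fun b => (x.2, b) :=
      Primrec.option_map (Primrec.decode.comp Primrec.snd)
        (Primrec.pair (Primrec.snd.comp (Primrec.fst.comp Primrec.fst)) Primrec.snd)
    exact (Primrec.option_bind h1 (Primrec.option_bind h2 h3).to₂).to_comp
  · intro a b
    have key : b ∈ f a ↔ Encodable.encode b ∈ c.eval (Encodable.encode a) := by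
      rw [hc]
      simp
    rw [key, Nat.Partrec.Code.evaln_complete]
    constructor
    · rintro ⟨k, hk⟩
      refine ⟨Nat.pair k (Encodable.encode a), ?_⟩
      rw [Option.mem_def] at hk
      simp [hk]
    · rintro ⟨i, hi⟩
      simp only [Option.bind_eq_some_iff, Option.map_eq_some_iff, Prod.mk.injEq] at hi
      obtain ⟨a', -, m, hm, b', hb', rfl, rfl⟩ := hi
      refine ⟨i.unpair.1, ?_⟩
      have : m ∈ c.eval (Encodable.encode a') := Nat.Partrec.Code.evaln_sound hm
      rw [hc] at this
      simp only [Encodable.encodek, Part.coe_some, Part.bind_some, Part.mem_map_iff] at this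
      obtain ⟨b'', -, rfl⟩ := this
      rw [Encodable.encodek] at hb'
      cases hb'
      exact hm

/-! ### Enumerations without repetition -/

section Enumeration

variable {β : Type*}

/-- The elements enumerated before stage `k`. -/
def enumSeen (e : ℕ → Option β) : ℕ → List β
  | 0 => []
  | k + 1 => (e k).elim (enumSeen e k) fun b => b :: enumSeen e k

theorem mem_enumSeen {e : ℕ → Option β} {k : ℕ} {b : β} :
    b ∈ enumSeen e k ↔ ∃ i < k, e i = some b := by
  induction k with
  | zero => simp [enumSeen]
  | succ k ih =>
    simp only [Nat.lt_succ_iff_lt_or_eq, or_and_right, exists_or, exists_eq_left, ← ih]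
    rw [enumSeen]
    cases h : e k <;> simp [or_comm, eq_comm]

theorem computable_enumSeen [Primcodable β] {e : ℕ → Option β} (he : Computable e) :
    Computable (enumSeen e) := by
  have h2 : Computable₂ fun (x : ℕ × ℕ × List β) (b : β) => b :: x.2.2 :=
    Computable.list_cons.comp Computable.snd
      (Computable.snd.comp (Computable.snd.comp Computable.fst))
  have h1 : Computable₂ fun (_ : ℕ) (x : ℕ × List β) => (e x.1).elim x.2 fun b => b :: x.2 := by
    refine (Computable.option_casesOn (he.comp (Computable.fst.comp Computable.snd))
      (Computable.snd.comp Computable.snd) h2).of_eq fun x => ?_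
    dsimp only
    cases e x.2.1 <;> rfl
  refine (Computable.nat_rec Computable.id (Computable.const []) h1).of_eq fun k => ?_
  induction k with
  | zero => rfl
  | succ k ih =>
    rw [enumSeen, ← ih]
    rfl

/-- `e` is a computable enumeration of `S` without repetition, in which no element is enumerated at
a stage below its weight. -/
structure IsEnumeration [Primcodable β] (e : ℕ → Option β) (ℓ : β → ℕ) (S : Set β) : Prop where
  computable : Computable e
  le_index : ∀ i b, e i = some b → ℓ b ≤ i
  injective : ∀ i j b, e i = some b → e j = some b → i = j
  mem_iff : ∀ b, b ∈ S ↔ ∃ i, e i = some b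

theorem exists_isEnumeration [Primcodable β] {e : ℕ → Option β} (he : Computable e) {ℓ : β → ℕ} (hℓ : Primrec ℓ) :
    ∃ e', IsEnumeration e' ℓ {b | ∃ i, e i = some b} := by
  classical
  -- Reading only `i.unpair.1` repeats each element at arbitrarily late stages, so it survives the
  -- delay imposed by its weight; repetitions are removed afterwards.
  obtain ⟨f, hf⟩ : ∃ f : ℕ → Option β, f = fun i =>
    (e i.unpair.1).bind fun b => if ℓ b ≤ i then some b else none := ⟨_, rfl⟩
  have hfc : Computable f := by
    rw [hf]
    have : Primrec₂ fun (i : ℕ) (b : β) => if ℓ b ≤ i then some b else none :=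
      Primrec.ite (Primrec.nat_le.comp (hℓ.comp Primrec.snd) Primrec.fst)
        (Primrec.option_some.comp Primrec.snd) (Primrec.const none)
    exact Computable.option_bind (he.comp (Computable.fst.comp Computable.unpair)) this.to_comp
  have hfs : ∀ i b, f i = some b ↔ e i.unpair.1 = some b ∧ ℓ b ≤ i := by
    intro i b
    rw [hf]
    simp only [Option.bind_eq_some_iff, Option.ite_none_right_eq_some, Option.some.injEq]
    constructor
    · rintro ⟨a, h1, h2, rfl⟩
      exact ⟨h1, h2⟩
    · rintro ⟨h1, h2⟩
      exact ⟨b, h1, h2, rfl⟩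
  refine ⟨fun i => (f i).bind fun b => if b ∈ enumSeen f i then none else some b, ?_, ?_, ?_, ?_⟩
  · have : Primrec₂ fun (l : List β) (b : β) => if b ∈ l then none else some b :=
      Primrec.ite (primrecRel_mem_list.comp Primrec.snd Primrec.fst) (Primrec.const none)
        (Primrec.option_some.comp Primrec.snd)
    exact Computable.option_bind hfc (this.to_comp.comp
      ((computable_enumSeen hfc).comp Computable.fst) Computable.snd)
  · intro i b hb
    simp only [Option.bind_eq_some_iff, Option.ite_none_left_eq_some, Option.some.injEq] at hb
    obtain ⟨a, h1, -, rfl⟩ := hb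
    exact ((hfs _ _).1 h1).2
  · have key : ∀ i b, ((f i).bind fun b => if b ∈ enumSeen f i then none else some b) = some b →
        f i = some b ∧ ∀ j < i, f j ≠ some b := by
      intro i b hb
      simp only [Option.bind_eq_some_iff, Option.ite_none_left_eq_some, Option.some.injEq] at hb
      obtain ⟨a, h1, h2, rfl⟩ := hb
      refine ⟨h1, fun j hj hj' => h2 (mem_enumSeen.2 ⟨j, hj, hj'⟩)⟩
    intro i j b hi hj
    obtain ⟨h1, h2⟩ := key i b hi
    obtain ⟨h3, h4⟩ := key j b hj
    rcases lt_trichotomy i j with h | h | h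
    · exact absurd h1 (h4 i h)
    · exact h
    · exact absurd h3 (h2 j h)
  · intro b
    constructor
    · rintro ⟨i, hi⟩
      have hex : ∃ j, f j = some b :=
        ⟨Nat.pair i (ℓ b), (hfs _ _).2 ⟨by simpa using hi, Nat.right_le_pair _ _⟩⟩
      refine ⟨Nat.find hex, ?_⟩
      have hn : b ∉ enumSeen f (Nat.find hex) := by
        rw [mem_enumSeen]
        rintro ⟨j, hj, hj'⟩
        exact Nat.find_min hex hj hj'
      simp [Nat.find_spec hex, hn]
    · rintro ⟨i, hi⟩
      simp only [Option.bind_eq_some_iff, Option.ite_none_left_eq_some, Option.some.injEq] at hi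
      obtain ⟨a, h1, -, rfl⟩ := hi
      exact ⟨_, ((hfs _ _).1 h1).1⟩

/-- The numerator over `2 ^ k` of the sum of `2 ^ (-ℓ b)` over the elements `b` enumerated before
stage `k`. -/
def partialNum (e : ℕ → Option β) (ℓ : β → ℕ) : ℕ → ℕ
  | 0 => 0
  | k + 1 => 2 * partialNum e ℓ k + (e k).elim 0 fun b => 2 ^ (k + 1 - ℓ b)

theorem computable_partialNum [Primcodable β] {e : ℕ → Option β} (he : Computable e) {ℓ : β → ℕ}
    (hℓ : Primrec ℓ) : Computable (partialNum e ℓ) := by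
  have h2 : Computable₂ fun (x : ℕ × ℕ × ℕ) (b : β) => 2 ^ (x.2.1 + 1 - ℓ b) :=
    (primrec_nat_pow.comp (Primrec.const 2) (Primrec.nat_sub.comp (Primrec.succ.comp
      (Primrec.fst.comp (Primrec.snd.comp Primrec.fst))) (hℓ.comp Primrec.snd))).to_comp
  have h3 : Computable fun x : ℕ × ℕ × ℕ => (e x.2.1).elim 0 fun b => 2 ^ (x.2.1 + 1 - ℓ b) := by
    refine (Computable.option_casesOn (he.comp (Computable.fst.comp Computable.snd))
      (Computable.const 0) h2).of_eq fun x => ?_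
    cases e x.2.1 <;> rfl
  have h1 : Computable₂ fun (_ : ℕ) (x : ℕ × ℕ) =>
      2 * x.2 + (e x.1).elim 0 fun b => 2 ^ (x.1 + 1 - ℓ b) :=
    Primrec.nat_add.to_comp.comp (Primrec.nat_double.to_comp.comp
      (Computable.snd.comp Computable.snd)) h3
  refine (Computable.nat_rec Computable.id (Computable.const 0) h1).of_eq fun k => ?_
  induction k with
  | zero => rfl
  | succ k ih =>
    rw [partialNum, ← ih]
    rfl

/-- The weight `2 ^ (-ℓ b)` of the element enumerated at a stage. -/
noncomputable def stageWeight (e : ℕ → Option β) (ℓ : β → ℕ) (i : ℕ) : ℝ :=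
  (e i).elim 0 fun b => (2 : ℝ)⁻¹ ^ ℓ b

theorem stageWeight_nonneg (e : ℕ → Option β) (ℓ : β → ℕ) (i : ℕ) : 0 ≤ stageWeight e ℓ i := by
  unfold stageWeight
  cases e i <;> simp

/-- The sum of `2 ^ (-ℓ b)` over the elements enumerated before stage `k`. -/
noncomputable def partialSum (e : ℕ → Option β) (ℓ : β → ℕ) (k : ℕ) : ℝ :=
  ∑ i ∈ Finset.range k, stageWeight e ℓ i

theorem partialSum_mono (e : ℕ → Option β) (ℓ : β → ℕ) : Monotone (partialSum e ℓ) :=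
  monotone_nat_of_le_succ fun k => by
    rw [partialSum, partialSum, Finset.sum_range_succ]
    linarith [stageWeight_nonneg e ℓ k]

theorem partialSum_nonneg (e : ℕ → Option β) (ℓ : β → ℕ) (k : ℕ) : 0 ≤ partialSum e ℓ k :=
  Finset.sum_nonneg fun i _ => stageWeight_nonneg e ℓ i

variable [Primcodable β] {e : ℕ → Option β} {ℓ : β → ℕ} {S : Set β}

/-- The delay `le_index` makes `2 ^ k` a common denominator, so partial sums are computed in
integers. -/
theorem IsEnumeration.partialSum_eq (h : IsEnumeration e ℓ S) (k : ℕ) :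
    partialSum e ℓ k = partialNum e ℓ k / 2 ^ k := by
  induction k with
  | zero => simp [partialSum, partialNum]
  | succ k ih =>
    rw [partialSum, Finset.sum_range_succ, ← partialSum, ih, partialNum, stageWeight]
    cases hb : e k with
    | none =>
      simp only [Option.elim_none]
      push_cast
      field_simp
      ring
    | some b =>
      have hl := h.le_index k b hb
      obtain ⟨d, rfl⟩ := Nat.exists_eq_add_of_le hl
      simp only [Option.elim_some]
      rw [show ℓ b + d + 1 - ℓ b = d + 1 by omega, inv_pow]
      push_cast
      field_simp
      ring

theorem IsEnumeration.tsum_eq (h : IsEnumeration e ℓ S) :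
    ∑' i, ENNReal.ofReal (stageWeight e ℓ i) = ∑' b : S, (2 : ℝ≥0∞)⁻¹ ^ ℓ b := by
  choose g hg using fun b : S => (h.mem_iff b).1 b.2
  have hginj : Function.Injective g := by
    intro b c hbc
    have := hg b
    rw [hbc, hg c] at this
    exact Subtype.ext (Option.some.inj this).symm
  rw [← hginj.tsum_eq (f := fun i => ENNReal.ofReal (stageWeight e ℓ i))]
  · refine tsum_congr fun b => ?_
    rw [stageWeight, hg b, Option.elim_some, ENNReal.ofReal_pow (by norm_num),
      ENNReal.ofReal_inv_of_pos two_pos, ENNReal.ofReal_ofNat]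
  · intro i hi
    cases hb : e i with
    | none => simp [stageWeight, hb] at hi
    | some b =>
      have hbS : b ∈ S := (h.mem_iff b).2 ⟨i, hb⟩
      exact ⟨⟨b, hbS⟩, h.injective _ _ b (hg ⟨b, hbS⟩) hb⟩

theorem IsEnumeration.hasSum (h : IsEnumeration e ℓ S)
    (hS : ∑' b : S, (2 : ℝ≥0∞)⁻¹ ^ ℓ b ≠ ⊤) :
    HasSum (stageWeight e ℓ) (∑' b : S, (2 : ℝ≥0∞)⁻¹ ^ ℓ b).toReal := by
  rw [← h.tsum_eq] at hS ⊢
  have := ENNReal.hasSum_toReal hS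
  simpa only [ENNReal.toReal_ofReal (stageWeight_nonneg e ℓ _),
    ENNReal.tsum_toReal_eq fun _ => ENNReal.ofReal_ne_top] using this

theorem IsEnumeration.tendsto_partialSum (h : IsEnumeration e ℓ S)
    (hS : ∑' b : S, (2 : ℝ≥0∞)⁻¹ ^ ℓ b ≠ ⊤) :
    Filter.Tendsto (partialSum e ℓ) Filter.atTop
      (nhds (∑' b : S, (2 : ℝ≥0∞)⁻¹ ^ ℓ b).toReal) :=
  (h.hasSum hS).tendsto_sum_nat

theorem IsEnumeration.partialSum_le (h : IsEnumeration e ℓ S)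
    (hS : ∑' b : S, (2 : ℝ≥0∞)⁻¹ ^ ℓ b ≠ ⊤) (k : ℕ) :
    partialSum e ℓ k ≤ (∑' b : S, (2 : ℝ≥0∞)⁻¹ ^ ℓ b).toReal :=
  sum_le_hasSum _ (fun i _ => stageWeight_nonneg e ℓ i) (h.hasSum hS)

end Enumeration

/-! ### Sums over strings -/

/-- The `2 ^ n` strings of length `n` together contribute `g n`. -/
theorem tsum_binString (g : ℕ → ℝ≥0∞) :
    ∑' s : BinString, (2 : ℝ≥0∞)⁻¹ ^ s.length * g s.length = ∑' n, g n := by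
  rw [← (Equiv.sigmaFiberEquiv (List.length (α := Bool))).tsum_eq, ENNReal.tsum_sigma']
  refine tsum_congr fun n => ?_
  have h : ∀ s : {s : List Bool // s.length = n},
      (2 : ℝ≥0∞)⁻¹ ^ s.1.length * g s.1.length = 2⁻¹ ^ n * g n := fun s => by rw [s.2]
  change ∑' s : {s : List Bool // s.length = n}, (2 : ℝ≥0∞)⁻¹ ^ s.1.length * g s.1.length = _
  simp_rw [h]
  have : Fintype {s : List Bool // s.length = n} :=
    inferInstanceAs (Fintype (List.Vector Bool n))
  have hc : Fintype.card {s : List Bool // s.length = n} = 2 ^ n := by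
    have := card_vector (α := Bool) n
    rw [Fintype.card_bool] at this
    rw [← this]
    exact Fintype.card_congr (Equiv.refl _)
  rw [tsum_fintype, Finset.sum_const, Finset.card_univ, hc, nsmul_eq_mul, ← mul_assoc,
    Nat.cast_pow, Nat.cast_ofNat, ← mul_pow, ENNReal.mul_inv_cancel (by simp) (by simp), one_pow,
    one_mul]

/-- The first words of two equal concatenations are prefixes of one string, hence comparable, hence
equal. The empty word must be excluded: `{[]}` is prefix-free but not uniquely decodable. -/
theorem IsPrefixFreeSet.uniquelyDecodable {S : Set BinString} (hS : IsPrefixFreeSet S)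
    (h : [] ∉ S) : InformationTheory.UniquelyDecodable S := by
  intro L
  induction L with
  | nil =>
    intro M _ hM hLM
    cases M with
    | nil => rfl
    | cons w M =>
      simp only [List.flatten_nil, List.flatten_cons] at hLM
      have : w = [] := (List.append_eq_nil_iff.1 hLM.symm).1
      exact absurd (this ▸ hM w (by simp)) h
  | cons v L ih =>
    intro M hL hM hLM
    cases M with
    | nil =>
      simp only [List.flatten_nil, List.flatten_cons] at hLM
      have : v = [] := (List.append_eq_nil_iff.1 hLM).1
      exact absurd (this ▸ hL v (by simp)) h
    | cons w M =>
      simp only [List.flatten_cons] at hLM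
      have hv := hL v (by simp)
      have hw := hM w (by simp)
      have hvw : v = w := by
        rcases List.prefix_or_prefix_of_prefix (l₁ := v) (l₂ := w) ⟨_, rfl⟩ ⟨_, hLM.symm⟩ with h | h
        · exact hS v hv w hw h
        · exact (hS w hw v hv h).symm
      subst hvw
      rw [ih M (fun x hx => hL x (by simp [hx])) (fun x hx => hM x (by simp [hx]))
        (List.append_cancel_left hLM)]

theorem IsPrefixFreeSet.mono {S S' : Set BinString} (hS : IsPrefixFreeSet S) (h : S' ⊆ S) :
    IsPrefixFreeSet S' :=
  fun p hp q hq hpq => hS p (h hp) q (h hq) hpq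

theorem IsPrefixFreeSet.sum_le_one {S : Finset BinString}
    (hS : IsPrefixFreeSet (S : Set BinString)) : ∑ p ∈ S, (2 : ℝ)⁻¹ ^ p.length ≤ 1 := by
  by_cases h : [] ∈ S
  · have : S = {[]} := by
      refine Finset.eq_singleton_iff_unique_mem.2 ⟨h, fun q hq => ?_⟩
      exact (hS [] h q hq (List.nil_prefix)).symm
    simp [this]
  · simpa using InformationTheory.kraft_mcmillan_inequality (hS.uniquelyDecodable (by simpa using h))

/-- Kraft's inequality for a family of distinct strings from a prefix-free set. -/
theorem IsPrefixFreeSet.tsum_le_one {S : Set BinString} (hS : IsPrefixFreeSet S) {ι : Type*}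
    {p : ι → BinString} (hp : Function.Injective p) (hpS : ∀ i, p i ∈ S) :
    ∑' i, (2 : ℝ≥0∞)⁻¹ ^ (p i).length ≤ 1 := by
  classical
  rw [ENNReal.tsum_eq_iSup_sum]
  refine iSup_le fun F => ?_
  rw [← Finset.sum_image (f := fun q : BinString => (2 : ℝ≥0∞)⁻¹ ^ q.length)
    (s := F) (g := p) (fun x _ y _ h => hp h)]
  have hF : IsPrefixFreeSet ((F.image p : Finset BinString) : Set BinString) :=
    hS.mono fun q hq => by
      simp only [Finset.coe_image, Set.mem_image] at hq
      obtain ⟨i, -, rfl⟩ := hq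
      exact hpS i
  have h := ENNReal.ofReal_le_ofReal hF.sum_le_one
  rw [ENNReal.ofReal_one, ENNReal.ofReal_sum_of_nonneg fun _ _ => by positivity] at h
  refine le_of_eq_of_le (Finset.sum_congr rfl fun q _ => ?_) h
  rw [ENNReal.ofReal_pow (by norm_num), ENNReal.ofReal_inv_of_pos two_pos, ENNReal.ofReal_ofNat]

/-! ### Program size -/

/-- Reduces complexity bounds to explicit programs, the only form used later. -/
theorem programSizeE_lt_iff {C : BinString →. BinString} {s : BinString} {x : ℝ} :
    programSizeE C s < (x : EReal) ↔ ∃ p, s ∈ C p ∧ (p.length : ℝ) < x := by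
  have key : ∀ n : ℕ, (((n : ℕ∞) : ℝ≥0∞) : EReal) = ((n : ℝ) : EReal) := fun n => by
    rw [ENat.toENNReal_coe, ← ENNReal.ofReal_natCast, EReal.coe_ennreal_ofReal,
      max_eq_left n.cast_nonneg]
  constructor
  · intro h
    by_cases hne : ∃ p, s ∈ C p
    · obtain ⟨p, hp, hmin⟩ := exists_minimalFor_of_wellFoundedLT (fun p => s ∈ C p) List.length hne
      refine ⟨p, hp, ?_⟩
      have : programSize C s = p.length := by
        refine le_antisymm (iInf₂_le p hp) (le_iInf₂ fun q hq => ?_)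
        rcases le_total p.length q.length with h' | h'
        · exact_mod_cast h'
        · exact_mod_cast hmin hq h'
      rw [programSizeE, this, key] at h
      exact_mod_cast h
    · have : programSize C s = ⊤ := by
        refine top_le_iff.1 (le_iInf₂ fun q hq => absurd ⟨q, hq⟩ hne)
      rw [programSizeE, this] at h
      simp at h
  · rintro ⟨p, hp, hx⟩
    have h1 : programSize C s ≤ p.length := iInf₂_le p hp
    have h2 : programSizeE C s ≤ ((p.length : ℝ) : EReal) := by
      rw [← key]
      exact EReal.coe_ennreal_le_coe_ennreal_iff.2 (ENat.toENNReal_le.2 h1)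
    exact h2.trans_lt (by exact_mod_cast hx)

theorem le_programSizeE_iff {C : BinString →. BinString} {s : BinString} {x : ℝ} :
    (x : EReal) ≤ programSizeE C s ↔ ∀ p, s ∈ C p → x ≤ p.length := by
  rw [← not_lt, programSizeE_lt_iff]
  push Not
  rfl

theorem programSizeE_le {C : BinString →. BinString} {s p : BinString} {x : ℝ} (hp : s ∈ C p)
    (hx : (p.length : ℝ) ≤ x) : programSizeE C s ≤ (x : EReal) :=
  le_of_forall_gt_imp_ge_of_dense fun y hy => by
    induction y with
    | bot => simp at hy
    | top => exact le_top
    | coe y => exact (programSizeE_lt_iff.2 ⟨p, hp, hx.trans_lt (by exact_mod_cast hy)⟩).le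

theorem IsOptimalMachine.exists_program {U C : BinString →. BinString} (hU : IsOptimalMachine U)
    (hC : IsPrefixFreeMachine C) :
    ∃ d : ℕ, ∀ p s, s ∈ C p → ∃ q, s ∈ U q ∧ q.length ≤ p.length + d := by
  obtain ⟨d, hd⟩ := hU.2 C hC
  refine ⟨d, fun p s hs => ?_⟩
  obtain ⟨q, -, hq, hl⟩ := hd p (Part.dom_iff_mem.2 ⟨s, hs⟩)
  exact ⟨q, hq ▸ hs, hl⟩

/-- The strings with `H_V(s) < T * |s|`. -/
def compressibleSet (V : BinString →. BinString) (T : ℝ) : Set BinString :=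
  {s | programSizeE V s < ((T * (s.length : ℝ) : ℝ) : EReal)}

theorem mem_compressibleSet {V : BinString →. BinString} {T : ℝ} {s : BinString} :
    s ∈ compressibleSet V T ↔ ∃ p, s ∈ V p ∧ (p.length : ℝ) < T * s.length :=
  programSizeE_lt_iff

theorem compressibleSum_eq (V : BinString →. BinString) (T : ℝ) :
    compressibleSum V T = ∑' s : compressibleSet V T, (2 : ℝ≥0∞)⁻¹ ^ s.1.length :=
  rfl

/-- Kraft's inequality for one short program per string. The weight is left free because both `2 * 2
^ (-|s|)` and `2 ^ (-T|s|)` are needed. -/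
theorem tsum_compressibleSet_le_one {V : BinString →. BinString} (hV : IsPrefixFreeMachine V)
    {T : ℝ} {w : BinString → ℝ≥0∞}
    (hw : ∀ (s : BinString) (k : ℕ), (k : ℝ) < T * s.length → w s ≤ 2⁻¹ ^ k) :
    ∑' s : compressibleSet V T, w s ≤ 1 := by
  choose p hp hlt using fun s : compressibleSet V T => mem_compressibleSet.1 s.2
  have hinj : Function.Injective p := fun s t hst =>
    Subtype.ext (Part.mem_unique (hp s) (hst ▸ hp t))
  refine (ENNReal.tsum_le_tsum fun s => hw _ _ (hlt s)).trans
    (hV.2.tsum_le_one hinj fun s => Part.dom_iff_mem.2 ⟨_, hp s⟩)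

theorem compressibleSum_le_half {V : BinString →. BinString} (hV : IsPrefixFreeMachine V)
    {T : ℝ} (hT : T ≤ 1) : compressibleSum V T ≤ 2⁻¹ := by
  have h : ∑' s : compressibleSet V T, (2 * 2⁻¹ ^ s.1.length : ℝ≥0∞) ≤ 1 := by
    refine tsum_compressibleSet_le_one hV (w := fun s => 2 * 2⁻¹ ^ s.length) fun s k hk => ?_
    have hk' : k + 1 ≤ s.length := by
      have : (k : ℝ) < s.length :=
        hk.trans_le (mul_le_of_le_one_left (Nat.cast_nonneg _) hT)
      exact_mod_cast this
    calc (2 * 2⁻¹ ^ s.length : ℝ≥0∞) ≤ 2 * 2⁻¹ ^ (k + 1) := by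
          exact mul_le_mul' le_rfl
            (pow_le_pow_right_of_le_one' (ENNReal.inv_le_one.2 one_le_two) hk')
      _ = 2⁻¹ ^ k := by
          rw [pow_succ', ← mul_assoc, ENNReal.mul_inv_cancel (by simp) (by simp), one_mul]
  rw [ENNReal.tsum_mul_left, ← compressibleSum_eq] at h
  rwa [ENNReal.le_inv_iff_mul_le, mul_comm]

theorem exists_notMem_compressibleSet {V : BinString →. BinString} (hV : IsPrefixFreeMachine V)
    {T : ℝ} (hT : T ≤ 1) (m : ℕ) : ∃ s : BinString, s.length = m ∧ s ∉ compressibleSet V T := by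
  by_contra! hm
  have h1 := tsum_binString fun n => if n = m then 1 else 0
  rw [tsum_ite_eq] at h1
  have h2 : (1 : ℝ≥0∞) ≤ compressibleSum V T := by
    rw [← h1, compressibleSum_eq, tsum_subtype (compressibleSet V T)
      fun s : BinString => (2 : ℝ≥0∞)⁻¹ ^ s.length]
    refine ENNReal.tsum_le_tsum fun s => ?_
    by_cases hs : s.length = m
    · rw [Set.indicator_of_mem (hm s hs)]
      simp [hs]
    · simp [hs]
  exact absurd (h2.trans (compressibleSum_le_half hV hT)) (by simp)

/-! ### Binary digits -/

/-- The `n` last binary digits of a natural number, the most significant one first. -/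
def natBits (n v : ℕ) : BinString :=
  (List.range n).map fun i => decide (v / 2 ^ (n - 1 - i) % 2 = 1)

@[simp]
theorem length_natBits (n v : ℕ) : (natBits n v).length = n := by
  simp [natBits]

theorem primrec_natBits : Primrec₂ natBits := by
  have h : Primrec₂ fun (x : ℕ × ℕ) (i : ℕ) => decide (x.2 / 2 ^ (x.1 - 1 - i) % 2 = 1) := by
    refine PrimrecPred.decide (Primrec.eq.comp (Primrec.nat_mod.comp (Primrec.nat_div.comp
      (Primrec.snd.comp Primrec.fst) (primrec_nat_pow.comp (Primrec.const 2) (Primrec.nat_sub.comp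
        (Primrec.nat_sub.comp (Primrec.fst.comp Primrec.fst) (Primrec.const 1)) Primrec.snd)))
      (Primrec.const 2)) (Primrec.const 1))
  exact Primrec.list_map (Primrec.list_range.comp Primrec.fst) h

theorem natBits_injOn {n v w : ℕ} (hv : v < 2 ^ n) (hw : w < 2 ^ n)
    (h : natBits n v = natBits n w) : v = w := by
  refine Nat.eq_of_testBit_eq fun i => ?_
  by_cases hi : i < n
  · have := List.map_inj_left.1 h (n - 1 - i) (List.mem_range.2 (by omega))
    rw [show n - 1 - (n - 1 - i) = i by omega] at this
    simpa only [Nat.testBit_eq_decide_div_mod_eq] using this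
  · have h2 : 2 ^ n ≤ 2 ^ i := Nat.pow_le_pow_right two_pos (not_lt.1 hi)
    rw [Nat.testBit_lt_two_pow (hv.trans_le h2), Nat.testBit_lt_two_pow (hw.trans_le h2)]

/-- Prefixes correspond to containment of dyadic intervals. -/
theorem natBits_prefix {m n v w : ℕ} (hv : v < 2 ^ m) (hw : w < 2 ^ n)
    (h : natBits m v <+: natBits n w) : m ≤ n ∧ w / 2 ^ (n - m) = v := by
  have hmn : m ≤ n := by simpa using h.length_le
  refine ⟨hmn, ?_⟩
  have ht : natBits m v = (natBits n w).take m := by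
    simpa using List.prefix_iff_eq_take.1 h
  have hd : (natBits n w).take m = natBits m (w / 2 ^ (n - m)) := by
    rw [natBits, ← List.map_take, List.take_range, min_eq_left hmn, natBits]
    refine List.map_congr_left fun i hi => ?_
    rw [List.mem_range] at hi
    rw [Nat.div_div_eq_div_mul, ← pow_add, show n - m + (m - 1 - i) = n - 1 - i by omega]
  refine (natBits_injOn hv ?_ (ht.trans hd)).symm
  rw [Nat.div_lt_iff_lt_mul (by positivity), ← pow_add, show m + (n - m) = n by omega]
  exact hw

theorem binPrefix_eq_natBits (α : ℝ) (n : ℕ) :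
    binPrefix α n = natBits n ⌊(2 : ℝ) ^ n * Int.fract α⌋₊ := by
  refine List.map_congr_left fun i hi => ?_
  rw [List.mem_range] at hi
  have h0 : 0 ≤ Int.fract α := Int.fract_nonneg α
  have h1 : ⌊(2 : ℝ) ^ (i + 1) * Int.fract α⌋₊ = ⌊(2 : ℝ) ^ n * Int.fract α⌋₊ / 2 ^ (n - 1 - i) := by
    rw [← Nat.floor_div_natCast]
    congr 1
    push_cast
    rw [eq_div_iff (by positivity), mul_right_comm, ← pow_add]
    congr 2
    omega
  rw [← h1, ← Int.natCast_floor_eq_floor (by positivity)]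
  congr 1
  simp only [eq_iff_iff]
  norm_cast

/-! ### The Kraft–Chaitin theorem -/

/-- The left endpoint, in units of `2 ^ (-(l + 1))`, of the dyadic interval assigned to a request of
length `l` at stage `i`. -/
def kraftIndex (e : ℕ → Option (ℕ × BinString)) (i l : ℕ) : ℕ :=
  (partialNum e Prod.fst i * 2 ^ (l + 1) + (2 ^ i - 1)) / 2 ^ i

theorem computable_kraftIndex {e : ℕ → Option (ℕ × BinString)} (he : Computable e) :
    Computable₂ (kraftIndex e) := by
  have h1 : Computable fun x : ℕ × ℕ => partialNum e Prod.fst x.1 :=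
    (computable_partialNum he Primrec.fst).comp Computable.fst
  have h2 : Primrec fun x : ℕ × ℕ => 2 ^ (x.2 + 1) :=
    primrec_nat_pow.comp (Primrec.const 2) (Primrec.succ.comp Primrec.snd)
  have h3 : Primrec fun x : ℕ × ℕ => 2 ^ x.1 :=
    primrec_nat_pow.comp (Primrec.const 2) Primrec.fst
  exact Primrec.nat_div.to_comp.comp (Primrec.nat_add.to_comp.comp
    (Primrec.nat_mul.to_comp.comp h1 h2.to_comp)
    (Primrec.nat_sub.comp h3 (Primrec.const 1)).to_comp) h3.to_comp

section KraftChaitin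

variable {e : ℕ → Option (ℕ × BinString)} {R : Set (ℕ × BinString)}

/-- Adding `2 ^ i - 1` before dividing rounds up. With the next lemma, the interval assigned at
stage `i` lies between the partial sums `i` and `i + 1`: a gap of `2 ^ (-l)` always contains an
aligned dyadic interval of half that length. -/
theorem IsEnumeration.le_kraftIndex (h : IsEnumeration e Prod.fst R) (i l : ℕ) :
    partialSum e Prod.fst i * 2 ^ (l + 1) ≤ kraftIndex e i l := by
  have h1 : partialNum e Prod.fst i * 2 ^ (l + 1) ≤ kraftIndex e i l * 2 ^ i := by
    have h2 := Nat.div_add_mod (partialNum e Prod.fst i * 2 ^ (l + 1) + (2 ^ i - 1)) (2 ^ i)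
    have h3 := Nat.mod_lt (partialNum e Prod.fst i * 2 ^ (l + 1) + (2 ^ i - 1))
      (Nat.two_pow_pos i)
    rw [kraftIndex, mul_comm _ (2 ^ i)]
    omega
  rw [h.partialSum_eq, div_mul_eq_mul_div, div_le_iff₀ (by positivity)]
  exact_mod_cast h1

theorem IsEnumeration.kraftIndex_add_one_le (h : IsEnumeration e Prod.fst R) {i l : ℕ}
    {s : BinString} (hi : e i = some (l, s)) :
    (kraftIndex e i l + 1 : ℝ) ≤ partialSum e Prod.fst (i + 1) * 2 ^ (l + 1) := by
  have h1 : kraftIndex e i l * 2 ^ i + 1 ≤ partialNum e Prod.fst i * 2 ^ (l + 1) + 2 ^ i := by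
    have h2 := Nat.div_mul_le_self (partialNum e Prod.fst i * 2 ^ (l + 1) + (2 ^ i - 1)) (2 ^ i)
    have h3 := Nat.two_pow_pos i
    rw [kraftIndex]
    omega
  have h2 : (kraftIndex e i l * 2 ^ i + 1 : ℝ) ≤
      partialNum e Prod.fst i * 2 ^ (l + 1) + 2 ^ i := by exact_mod_cast h1
  have h3 : stageWeight e Prod.fst i * 2 ^ (l + 1) = 2 := by
    rw [stageWeight, hi, Option.elim_some, pow_succ, ← mul_assoc, ← mul_pow,
      inv_mul_cancel₀ two_ne_zero, one_pow, one_mul]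
  rw [partialSum, Finset.sum_range_succ, ← partialSum, add_mul, h3, h.partialSum_eq,
    div_mul_eq_mul_div, ← sub_le_iff_le_add, le_div_iff₀ (by positivity)]
  linarith

/-- A prefix relation would nest the two dyadic intervals, but intervals of different stages do not
overlap. -/
theorem IsEnumeration.eq_of_kraft_prefix (h : IsEnumeration e Prod.fst R) {c : ℕ}
    (hR : ∀ i, partialSum e Prod.fst i ≤ 2 ^ c) {i j l m : ℕ} {s t : BinString}
    (hi : e i = some (l, s)) (hj : e j = some (m, t))
    (hp : natBits (l + 1 + c) (kraftIndex e i l) <+: natBits (m + 1 + c) (kraftIndex e j m)) :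
    i = j := by
  -- The `c` extra digits accommodate a total weight up to `2 ^ c` instead of `1`.
  have hlt : ∀ {i l s}, e i = some (l, s) → kraftIndex e i l < 2 ^ (l + 1 + c) := by
    intro i l s hi
    have h1 : (kraftIndex e i l + 1 : ℝ) ≤ 2 ^ c * 2 ^ (l + 1) :=
      (h.kraftIndex_add_one_le hi).trans (by gcongr; exact hR _)
    rw [← pow_add, add_comm c] at h1
    have h2 : kraftIndex e i l + 1 ≤ 2 ^ (l + 1 + c) := by exact_mod_cast h1
    omega
  obtain ⟨hle, hdiv⟩ := natBits_prefix (hlt hi) (hlt hj) hp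
  obtain ⟨d, hd⟩ : ∃ d, m = l + d := Nat.exists_eq_add_of_le (by omega)
  subst hd
  rw [show l + d + 1 + c - (l + 1 + c) = d by omega] at hdiv
  have hd0 : 0 < 2 ^ d := Nat.two_pow_pos d
  have h1 : kraftIndex e i l * 2 ^ d ≤ kraftIndex e j (l + d) := by
    rw [← hdiv]
    exact Nat.div_mul_le_self _ _
  have h2 : kraftIndex e j (l + d) < (kraftIndex e i l + 1) * 2 ^ d := by
    rw [← hdiv, mul_comm]
    exact Nat.lt_mul_div_succ _ hd0
  have h1' : (kraftIndex e i l : ℝ) * 2 ^ d ≤ kraftIndex e j (l + d) := by exact_mod_cast h1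
  have h2' : (kraftIndex e j (l + d) : ℝ) < (kraftIndex e i l + 1) * 2 ^ d := by exact_mod_cast h2
  have hpow : (2 : ℝ) ^ (l + d + 1) = 2 ^ (l + 1) * 2 ^ d := by rw [← pow_add]; congr 1; omega
  rcases lt_trichotomy i j with hij | hij | hij
  · exfalso
    have h3 := h.kraftIndex_add_one_le hi
    have h4 := h.le_kraftIndex j (l + d)
    have h5 : partialSum e Prod.fst (i + 1) ≤ partialSum e Prod.fst j := partialSum_mono _ _ hij
    have h6 : (kraftIndex e i l + 1 : ℝ) * 2 ^ d ≤ kraftIndex e j (l + d) := by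
      calc (kraftIndex e i l + 1 : ℝ) * 2 ^ d
          ≤ partialSum e Prod.fst (i + 1) * 2 ^ (l + 1) * 2 ^ d := by gcongr
        _ ≤ partialSum e Prod.fst j * 2 ^ (l + 1) * 2 ^ d := by gcongr
        _ = partialSum e Prod.fst j * 2 ^ (l + d + 1) := by rw [hpow, mul_assoc]
        _ ≤ _ := h4
    linarith
  · exact hij
  · exfalso
    have h3 := h.kraftIndex_add_one_le hj
    have h4 := h.le_kraftIndex i l
    have h5 : partialSum e Prod.fst (j + 1) ≤ partialSum e Prod.fst i := partialSum_mono _ _ hij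
    have h6 : (kraftIndex e j (l + d) + 1 : ℝ) ≤ kraftIndex e i l * 2 ^ d := by
      calc (kraftIndex e j (l + d) + 1 : ℝ)
          ≤ partialSum e Prod.fst (j + 1) * 2 ^ (l + d + 1) := h3
        _ ≤ partialSum e Prod.fst i * 2 ^ (l + d + 1) := by gcongr
        _ = partialSum e Prod.fst i * 2 ^ (l + 1) * 2 ^ d := by rw [hpow, mul_assoc]
        _ ≤ _ := by gcongr
    linarith

end KraftChaitin

/-- The Kraft–Chaitin theorem: a computably enumerable set of requests of finite total weight is
satisfied, up to an additive constant, by a prefix-free machine. -/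
theorem exists_machine_of_requests {r : ℕ → Option (ℕ × BinString)} (hr : Computable r)
    (hsum : ∑' b : {b | ∃ i, r i = some b}, (2 : ℝ≥0∞)⁻¹ ^ b.1.1 ≠ ⊤) :
    ∃ C, IsPrefixFreeMachine C ∧ ∃ c : ℕ, ∀ i l s, r i = some (l, s) →
      ∃ p : BinString, s ∈ C p ∧ p.length = l + c := by
  obtain ⟨e, he⟩ := exists_isEnumeration hr (ℓ := Prod.fst) Primrec.fst
  obtain ⟨c, hc⟩ : ∃ c : ℕ, ∀ i, partialSum e Prod.fst i ≤ 2 ^ c := by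
    obtain ⟨c, hc⟩ := pow_unbounded_of_one_lt
      (∑' b : {b | ∃ i, r i = some b}, (2 : ℝ≥0∞)⁻¹ ^ b.1.1).toReal (one_lt_two (α := ℝ))
    exact ⟨c, fun i => (he.partialSum_le hsum i).trans hc.le⟩
  obtain ⟨g, hg⟩ : ∃ g : BinString → ℕ → Option BinString, g = fun p i => (e i).bind fun b =>
    if natBits (b.1 + 1 + c) (kraftIndex e i b.1) = p then some b.2 else none := ⟨_, rfl⟩
  have hgs : ∀ p i s, g p i = some s ↔
      ∃ l, e i = some (l, s) ∧ natBits (l + 1 + c) (kraftIndex e i l) = p := by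
    intro p i s
    simp [hg, Option.bind_eq_some_iff]
  have hgc : Computable₂ g := by
    have h1 : Computable fun x : (BinString × ℕ) × ℕ × BinString =>
        natBits (x.2.1 + 1 + c) (kraftIndex e x.1.2 x.2.1) :=
      primrec_natBits.to_comp.comp (Primrec.nat_add.comp (Primrec.succ.comp
        (Primrec.fst.comp Primrec.snd)) (Primrec.const c)).to_comp
        ((computable_kraftIndex he.computable).comp (Computable.snd.comp Computable.fst)
          (Computable.fst.comp Computable.snd))
    have h2 : Primrec fun y : BinString × BinString × BinString =>
        if y.1 = y.2.1 then some y.2.2 else none :=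
      Primrec.ite (Primrec.eq.comp Primrec.fst (Primrec.fst.comp Primrec.snd))
        (Primrec.option_some.comp (Primrec.snd.comp Primrec.snd)) (Primrec.const none)
    have h3 : Computable₂ fun (x : BinString × ℕ) (b : ℕ × BinString) =>
        if natBits (b.1 + 1 + c) (kraftIndex e x.2 b.1) = x.1 then some b.2 else none :=
      h2.to_comp.comp (Computable.pair h1 (Computable.pair (Computable.fst.comp Computable.fst)
        (Computable.snd.comp Computable.snd)))
    rw [hg]
    exact Computable.option_bind (he.computable.comp Computable.snd) h3
  have hmem : ∀ p s, s ∈ Nat.rfindOpt (g p) → ∃ i l, e i = some (l, s) ∧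
      natBits (l + 1 + c) (kraftIndex e i l) = p := by
    intro p s hs
    obtain ⟨i, hi⟩ := Nat.rfindOpt_spec hs
    exact ⟨i, (hgs _ _ _).1 hi⟩
  refine ⟨fun p => Nat.rfindOpt (g p), ⟨Partrec.rfindOpt hgc, ?_⟩, c + 1, ?_⟩
  · intro p hp q hq hpq
    obtain ⟨s, hs⟩ := Part.dom_iff_mem.1 hp
    obtain ⟨t, ht⟩ := Part.dom_iff_mem.1 hq
    obtain ⟨i, l, hi, rfl⟩ := hmem _ _ hs
    obtain ⟨j, m, hj, rfl⟩ := hmem _ _ ht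
    obtain rfl := he.eq_of_kraft_prefix hc hi hj hpq
    rw [hi] at hj
    cases hj
    rfl
  · intro i l s hi
    obtain ⟨j, hj⟩ := (he.mem_iff (l, s)).1 ⟨i, hi⟩
    refine ⟨natBits (l + 1 + c) (kraftIndex e j l), ?_, by rw [length_natBits]; omega⟩
    have hdom : (Nat.rfindOpt (g (natBits (l + 1 + c) (kraftIndex e j l)))).Dom :=
      Nat.rfindOpt_dom.2 ⟨j, s, (hgs _ _ _).2 ⟨l, hj, rfl⟩⟩
    obtain ⟨t, ht⟩ := Part.dom_iff_mem.1 hdom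
    obtain ⟨k, m, hk, hkp⟩ := hmem _ _ ht
    -- The search may stop at another stage `k`, but equal codes force `k = j`.
    have hkj : k = j := he.eq_of_kraft_prefix hc hk hj (by rw [hkp])
    rw [hkj, hj] at hk
    cases hk
    exact ht

theorem IsOptimalMachine.exists_program_of_requests {U : BinString →. BinString}
    (hU : IsOptimalMachine U) {r : ℕ → Option (ℕ × BinString)} (hr : Computable r)
    (hsum : ∑' b : {b | ∃ i, r i = some b}, (2 : ℝ≥0∞)⁻¹ ^ b.1.1 ≠ ⊤) :
    ∃ c : ℕ, ∀ i l s, r i = some (l, s) → ∃ p, s ∈ U p ∧ p.length ≤ l + c := by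
  obtain ⟨C, hC, c, hc⟩ := exists_machine_of_requests hr hsum
  obtain ⟨d, hd⟩ := hU.exists_program hC
  refine ⟨c + d, fun i l s h => ?_⟩
  obtain ⟨p, hp, hpl⟩ := hc i l s h
  obtain ⟨q, hq, hql⟩ := hd p s hp
  exact ⟨q, hq, by omega⟩

/-! ### Divergence for `T > 1` -/

/-- Each exponent occurs `m` times, giving `m` times a geometric series. -/
theorem ENNReal.tsum_pow_div_ne_top {x : ℝ≥0∞} (hx : x < 1) (m : ℕ) [NeZero m] :
    ∑' n : ℕ, x ^ (n / m) ≠ ⊤ := by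
  rw [← (Nat.divModEquiv m).symm.tsum_eq]
  have h : ∀ b : ℕ × Fin m, x ^ ((Nat.divModEquiv m).symm b / m) = x ^ b.1 := by
    rintro ⟨a, b⟩
    congr 1
    simp [Nat.divModEquiv, Nat.add_div_of_dvd_right, Nat.div_eq_of_lt b.2,
      Nat.mul_div_cancel _ (NeZero.pos m)]
  simp_rw [h]
  rw [ENNReal.tsum_prod (f := fun a _ => x ^ a)]
  simp_rw [tsum_fintype, Finset.sum_const, Finset.card_univ, Fintype.card_fin, nsmul_eq_mul]
  rw [ENNReal.tsum_mul_left, ENNReal.tsum_geometric]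
  refine ENNReal.mul_ne_top (by simp) (ENNReal.inv_ne_top.2 ?_)
  exact (tsub_pos_of_lt hx).ne'

theorem IsOptimalMachine.exists_program_length {V : BinString →. BinString}
    (hV : IsOptimalMachine V) {m : ℕ} (hm : m ≠ 0) :
    ∃ c : ℕ, ∀ s, ∃ p, s ∈ V p ∧ p.length ≤ s.length + s.length / m + c := by
  have : NeZero m := ⟨hm⟩
  have hr : Computable fun i : ℕ => (Encodable.decode (α := BinString) i).map fun s =>
      (s.length + s.length / m, s) := by
    have : Primrec₂ fun (_ : ℕ) (s : BinString) => (s.length + s.length / m, s) :=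
      Primrec.pair (Primrec.nat_add.comp (Primrec.list_length.comp Primrec.snd)
        (Primrec.nat_div.comp (Primrec.list_length.comp Primrec.snd) (Primrec.const m))) Primrec.snd
    exact (Primrec.option_map Primrec.decode this).to_comp
  obtain ⟨c, hc⟩ := hV.exists_program_of_requests hr <| by
    refine ne_top_of_le_ne_top (ENNReal.tsum_pow_div_ne_top (x := 2⁻¹) (by simp) m) ?_
    rw [← tsum_binString]
    have hs : ∀ b : {b : ℕ × BinString | ∃ i : ℕ, (Encodable.decode (α := BinString) i).map (fun s =>
        (s.length + s.length / m, s)) = some b},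
        b.1.1 = b.1.2.length + b.1.2.length / m := by
      rintro ⟨b, i, hi⟩
      obtain ⟨s, -, rfl⟩ := Option.map_eq_some_iff.1 hi
      rfl
    simp_rw [hs, pow_add]
    refine ENNReal.tsum_comp_le_tsum_of_injective (f := fun b : {b : ℕ × BinString | ∃ i : ℕ,
      (Encodable.decode (α := BinString) i).map (fun s =>
        (s.length + s.length / m, s)) = some b} => b.1.2) (fun a b hab => ?_)
      fun s : BinString => (2 : ℝ≥0∞)⁻¹ ^ s.length * 2⁻¹ ^ (s.length / m)
    refine Subtype.ext (Prod.ext ?_ hab)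
    rw [hs, hs]
    exact congrArg (fun s : BinString => s.length + s.length / m) hab
  refine ⟨c, fun s => hc (Encodable.encode s) _ s ?_⟩
  simp

theorem compressibleSum_eq_top {V : BinString →. BinString} (hV : IsOptimalMachine V) {T : ℝ}
    (hT : 1 < T) : compressibleSum V T = ⊤ := by
  -- The excess `(T - 1)|s|` is split in halves: `m` makes `|s| / m` fit into one, `N` makes `c` fit
  -- into the other.
  obtain ⟨m, hm⟩ := exists_nat_gt (2 / (T - 1))
  have hT' : 0 < T - 1 := sub_pos.2 hT
  have hm0 : (0 : ℝ) < m := lt_trans (by positivity) hm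
  obtain ⟨c, hc⟩ := hV.exists_program_length (m := m) (by rintro rfl; simp at hm0)
  obtain ⟨N, hN⟩ := exists_nat_gt (2 * c / (T - 1))
  have hmem : ∀ s : BinString, N ≤ s.length → s ∈ compressibleSet V T := by
    intro s hs
    obtain ⟨p, hp, hpl⟩ := hc s
    refine mem_compressibleSet.2 ⟨p, hp, ?_⟩
    have h1 : (p.length : ℝ) ≤ s.length + s.length / m + c := by
      refine (Nat.cast_le.2 hpl).trans ?_
      push_cast
      gcongr
      exact Nat.cast_div_le
    have h2 : (N : ℝ) ≤ s.length := by exact_mod_cast hs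
    rw [div_lt_iff₀ hT'] at hN hm
    have h3 : (s.length : ℝ) / m ≤ s.length * ((T - 1) / 2) := by
      rw [div_le_iff₀ hm0, mul_assoc]
      exact le_mul_of_one_le_right (Nat.cast_nonneg _) (by linarith)
    nlinarith
  have h1 := tsum_binString fun n => if N ≤ n then 1 else 0
  have h2 : ∑' n : ℕ, (if N ≤ n then (1 : ℝ≥0∞) else 0) = ⊤ := by
    refine top_le_iff.1 ?_
    calc (⊤ : ℝ≥0∞) = ∑' _ : ℕ, 1 := (ENNReal.tsum_const_eq_top_of_ne_zero one_ne_zero).symm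
      _ = ∑' n : ℕ, (fun n => if N ≤ n then (1 : ℝ≥0∞) else 0) (n + N) := by simp
      _ ≤ _ := ENNReal.tsum_comp_le_tsum_of_injective (add_left_injective N) _
  rw [h2] at h1
  refine top_le_iff.1 ?_
  rw [← h1, compressibleSum_eq, tsum_subtype (compressibleSet V T)
    fun s : BinString => (2 : ℝ≥0∞)⁻¹ ^ s.length]
  refine ENNReal.tsum_le_tsum fun s => ?_
  by_cases hs : N ≤ s.length
  · rw [Set.indicator_of_mem (hmem s hs)]
    simp [hs]
  · simp [hs]

/-! ### Left-computability and randomness -/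

theorem exists_enumeration_compressibleSet {V : BinString →. BinString} (hV : Partrec V) {T : ℝ}
    (hT : IsLeftComputable T) :
    ∃ e, IsEnumeration e List.length (compressibleSet V T) := by
  obtain ⟨f, ⟨a, b, ha, hb, hf⟩, hle, hlim⟩ := hT
  obtain ⟨h, hhc, hh⟩ := exists_computable_graph hV
  -- `|p| < T|s|` holds iff some rational lower bound of `T` witnesses it, so pairs of a computation
  -- and a bound are searched. The shift by one avoids the unconstrained index `0`; `toNat` turns a
  -- negative bound into a failing test.
  obtain ⟨r, hr⟩ : ∃ r : ℕ → Option BinString, r = fun i => (h i.unpair.1).bind fun x =>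
    if x.1.length * b (i.unpair.2 + 1) < (-a (i.unpair.2 + 1)).toNat * x.2.length then some x.2
    else none := ⟨_, rfl⟩
  have hrc : Computable r := by
    have hn : Computable fun i : ℕ => i.unpair.2 + 1 :=
      (Primrec.succ.comp (Primrec.snd.comp Primrec.unpair)).to_comp
    have h1 : Computable fun x : ℕ × BinString × BinString => x.2.1.length * b (x.1.unpair.2 + 1) :=
      Primrec.nat_mul.to_comp.comp (Primrec.list_length.comp (Primrec.fst.comp Primrec.snd)).to_comp
        (hb.comp (hn.comp Computable.fst))
    have h2 : Computable fun x : ℕ × BinString × BinString =>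
        (-a (x.1.unpair.2 + 1)).toNat * x.2.2.length :=
      Primrec.nat_mul.to_comp.comp ((primrec_int_toNat.comp primrec_int_neg).to_comp.comp
        (ha.comp (hn.comp Computable.fst)))
        (Primrec.list_length.comp (Primrec.snd.comp Primrec.snd)).to_comp
    have h3 : Primrec fun y : (ℕ × ℕ) × BinString => if y.1.1 < y.1.2 then some y.2 else none :=
      Primrec.ite (Primrec.nat_lt.comp (Primrec.fst.comp Primrec.fst)
        (Primrec.snd.comp Primrec.fst)) (Primrec.option_some.comp Primrec.snd) (Primrec.const none)
    rw [hr]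
    exact Computable.option_bind (hhc.comp (Computable.fst.comp Computable.unpair))
      (h3.to_comp.comp (Computable.pair (Computable.pair h1 h2)
        (Computable.snd.comp Computable.snd))).to₂
  obtain ⟨e, he⟩ := exists_isEnumeration hrc Primrec.list_length
  refine ⟨e, ?_⟩
  have hS : {s | ∃ i, r i = some s} = compressibleSet V T := by
    ext s
    rw [mem_compressibleSet]
    simp only [Set.mem_ofPred_eq, hr, Option.bind_eq_some_iff, Option.ite_none_right_eq_some,
      Option.some.injEq]
    constructor
    · rintro ⟨i, ⟨p, s'⟩, hi, hlt, rfl⟩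
      refine ⟨p, (hh _ _).2 ⟨_, hi⟩, ?_⟩
      obtain ⟨hb0, hfn⟩ := hf (i.unpair.2 + 1)
      have hTn := hle (i.unpair.2 + 1) (by omega)
      dsimp only at hlt
      generalize i.unpair.2 + 1 = n at *
      have ha0 : 0 ≤ -a n := by
        by_contra hneg
        rw [Int.toNat_of_nonpos (by omega), zero_mul] at hlt
        exact absurd hlt (Nat.not_lt_zero _)
      have hlt' : ((p.length * b n : ℕ) : ℤ) < -a n * s'.length := by
        rw [← Int.toNat_of_nonneg ha0]
        exact_mod_cast hlt
      have hlt'' : (p.length * b n : ℝ) < -a n * s'.length := by exact_mod_cast hlt'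
      have hb1 : (0 : ℝ) < b n := by exact_mod_cast Nat.pos_of_ne_zero hb0
      have h1 : -(a n : ℝ) / b n ≤ T := by
        rw [hfn] at hTn
        push_cast at hTn
        rw [neg_div]
        linarith
      have h2 : (p.length : ℝ) < -(a n : ℝ) / b n * s'.length := by
        rw [div_mul_eq_mul_div, lt_div_iff₀ hb1]
        exact hlt''
      exact h2.trans_le (by gcongr)
    · rintro ⟨p, hp, hlt⟩
      obtain ⟨i, hi⟩ := (hh _ _).1 hp
      have hlim' : Filter.Tendsto (fun n => -(f n : ℝ) * s.length) Filter.atTop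
          (nhds (T * s.length)) := by
        simpa using hlim.neg.mul_const (s.length : ℝ)
      obtain ⟨n, hn, hn1⟩ := ((hlim'.eventually (lt_mem_nhds hlt)).and
        (Filter.eventually_ge_atTop 1)).exists
      obtain ⟨n, rfl⟩ : ∃ k, n = k + 1 := ⟨n - 1, by omega⟩
      refine ⟨Nat.pair i n, (p, s), by simpa using hi, ?_, rfl⟩
      rw [Nat.unpair_pair]
      dsimp only
      obtain ⟨hb0, hfn⟩ := hf (n + 1)
      have hb1 : (0 : ℝ) < b (n + 1) := by exact_mod_cast Nat.pos_of_ne_zero hb0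
      rw [hfn] at hn
      push_cast at hn
      rw [← neg_div, div_mul_eq_mul_div, lt_div_iff₀ hb1] at hn
      have hn' : ((p.length * b (n + 1) : ℕ) : ℤ) < -a (n + 1) * s.length := by exact_mod_cast hn
      have h3 : -a (n + 1) * s.length ≤ (((-a (n + 1)).toNat * s.length : ℕ) : ℤ) := by
        push_cast
        gcongr
        exact Int.self_le_toNat _
      exact_mod_cast hn'.trans_le h3
  rwa [hS] at he

theorem IsEnumeration.isLeftComputable {β : Type*} [Primcodable β] {e : ℕ → Option β} {ℓ : β → ℕ}
    {S : Set β} (h : IsEnumeration e ℓ S) (hℓ : Primrec ℓ)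
    (hS : ∑' b : S, (2 : ℝ≥0∞)⁻¹ ^ ℓ b ≠ ⊤) :
    IsLeftComputable (∑' b : S, (2 : ℝ≥0∞)⁻¹ ^ ℓ b).toReal := by
  have hcast : ∀ k, ((-(partialNum e ℓ k : ℤ) : ℤ) / (2 ^ k : ℕ) : ℚ) =
      -(partialNum e ℓ k / 2 ^ k : ℚ) := fun k => by
    push_cast
    rw [neg_div]
  have hR : ∀ k, (((-(partialNum e ℓ k : ℤ) : ℤ) / (2 ^ k : ℕ) : ℚ) : ℝ) =
      -partialSum e ℓ k := fun k => by
    rw [hcast, h.partialSum_eq]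
    push_cast
    rfl
  refine ⟨fun k => ((-(partialNum e ℓ k : ℤ) : ℤ) / (2 ^ k : ℕ) : ℚ),
    ⟨fun k => -(partialNum e ℓ k : ℤ), fun k => 2 ^ k,
      primrec_neg_natCast.to_comp.comp (computable_partialNum h.computable hℓ),
      (primrec_nat_pow.comp (Primrec.const 2) Primrec.id).to_comp,
      fun k => ⟨(Nat.two_pow_pos k).ne', rfl⟩⟩, fun k _ => ?_, ?_⟩
  · rw [hR]
    exact neg_le_neg (h.partialSum_le hS k)
  · simp_rw [hR]
    exact (h.tendsto_partialSum hS).neg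

theorem fract_compressibleSum {V : BinString →. BinString}
    (hV : IsPrefixFreeMachine V) {T : ℝ} (hT : T ≤ 1) :
    Int.fract (compressibleSum V T).toReal = (compressibleSum V T).toReal := by
  rw [Int.fract_eq_self]
  refine ⟨ENNReal.toReal_nonneg, ?_⟩
  have h := ENNReal.toReal_mono (by simp) (compressibleSum_le_half hV hT)
  rw [ENNReal.toReal_inv] at h
  norm_num at h ⊢
  linarith

/-! ### Truncations of the limit and of the partial sums -/

theorem natFloor_le_of_lt_add_one {x y : ℝ} (h : y < x + 1) (hx : 0 ≤ x) : ⌊y⌋₊ ≤ ⌊x⌋₊ + 1 := by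
  rw [← Nat.floor_add_one hx]
  exact Nat.floor_mono h.le

/-- The `+ 1` cannot be dropped in general: if the scaled limit is an integer approached strictly
from below, no partial sum has the same floor. -/
theorem IsEnumeration.exists_natFloor_le {β : Type*} [Primcodable β] {e : ℕ → Option β} {ℓ : β → ℕ}
    {S : Set β} (h : IsEnumeration e ℓ S) (hS : ∑' b : S, (2 : ℝ≥0∞)⁻¹ ^ ℓ b ≠ ⊤) (n : ℕ) :
    ∃ k, ⌊2 ^ n * (∑' b : S, (2 : ℝ≥0∞)⁻¹ ^ ℓ b).toReal⌋₊ ≤ ⌊2 ^ n * partialSum e ℓ k⌋₊ + 1 := by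
  have h1 := ((h.tendsto_partialSum hS).const_mul (2 ^ n)).eventually
    (lt_mem_nhds (sub_one_lt _))
  obtain ⟨k, hk⟩ := h1.exists
  exact ⟨k, natFloor_le_of_lt_add_one (by linarith)
    (mul_nonneg (by positivity) (partialSum_nonneg _ _ _))⟩

theorem IsEnumeration.natFloor_partialSum {β : Type*} [Primcodable β] {e : ℕ → Option β}
    {ℓ : β → ℕ} {S : Set β} (h : IsEnumeration e ℓ S) (n k : ℕ) :
    ⌊2 ^ n * partialSum e ℓ k⌋₊ = 2 ^ n * partialNum e ℓ k / 2 ^ k := by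
  rw [h.partialSum_eq, ← mul_div_assoc]
  have := Nat.floor_div_eq_div (K := ℝ) (2 ^ n * partialNum e ℓ k) (2 ^ k)
  push_cast at this
  exact this

/-- A later arrival of weight `2 ^ (-m)` would push the partial sums above the total. -/
theorem IsEnumeration.mem_enumSeen_of_lt {β : Type*} [Primcodable β] {e : ℕ → Option β}
    {ℓ : β → ℕ} {S : Set β} (h : IsEnumeration e ℓ S) (hS : ∑' b : S, (2 : ℝ≥0∞)⁻¹ ^ ℓ b ≠ ⊤)
    {k m : ℕ} (hk : (∑' b : S, (2 : ℝ≥0∞)⁻¹ ^ ℓ b).toReal < partialSum e ℓ k + 2⁻¹ ^ m) {b : β}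
    (hb : b ∈ S) (hbm : ℓ b = m) : b ∈ enumSeen e k := by
  obtain ⟨i, hi⟩ := (h.mem_iff b).1 hb
  refine mem_enumSeen.2 ⟨i, ?_, hi⟩
  by_contra hik
  have h1 : partialSum e ℓ k + 2⁻¹ ^ m ≤ partialSum e ℓ (i + 1) := by
    rw [partialSum.eq_1 e ℓ (i + 1), Finset.sum_range_succ, ← partialSum, stageWeight, hi,
      Option.elim_some, hbm]
    gcongr
    exact partialSum_mono _ _ (not_lt.1 hik)
  linarith [h.partialSum_le hS (i + 1)]

/-- The search for a string of length `|a| - 1` which has not been enumerated at a stage where the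
sum agrees with the number coded by `a` up to an error less than `2 ^ (1 - |a|)`. -/
theorem exists_partrec_new_string {e : ℕ → Option BinString} (he : Computable e) :
    ∃ G : BinString →. BinString, Partrec G ∧
      (∀ a s, s ∈ G a → ∃ k v, natBits a.length v = a ∧ v < 2 ^ a.length ∧
        v ≤ 2 ^ a.length * partialNum e List.length k / 2 ^ k + 1 ∧ s.length + 1 = a.length ∧
        s ∉ enumSeen e k) ∧
      ∀ a k v s, natBits a.length v = a → v < 2 ^ a.length →
        v ≤ 2 ^ a.length * partialNum e List.length k / 2 ^ k + 1 → s.length + 1 = a.length →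
        s ∉ enumSeen e k → (G a).Dom := by
  classical
  -- The number `v` coded by `a` is searched for together with the stage and the string; `v < 2 ^
  -- a.length` makes it unique.
  obtain ⟨g, hg⟩ : ∃ g : BinString → ℕ → Option BinString, g = fun a j =>
      (Encodable.decode (α := ℕ × ℕ × BinString) j).bind fun x =>
      if natBits a.length x.2.1 = a ∧ x.2.1 < 2 ^ a.length ∧
        x.2.1 ≤ 2 ^ a.length * partialNum e List.length x.1 / 2 ^ x.1 + 1 ∧
        x.2.2.length + 1 = a.length ∧ x.2.2 ∉ enumSeen e x.1 then some x.2.2 else none := ⟨_, rfl⟩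
  have hgs : ∀ a j s, g a j = some s ↔ ∃ k v,
      Encodable.decode (α := ℕ × ℕ × BinString) j = some (k, v, s) ∧
      natBits a.length v = a ∧ v < 2 ^ a.length ∧
        v ≤ 2 ^ a.length * partialNum e List.length k / 2 ^ k + 1 ∧ s.length + 1 = a.length ∧
        s ∉ enumSeen e k := by
    intro a j s
    simp only [hg, Option.bind_eq_some_iff, Option.ite_none_right_eq_some, Option.some.injEq]
    constructor
    · rintro ⟨⟨k, v, s'⟩, h1, h2, rfl⟩
      exact ⟨k, v, h1, h2⟩
    · rintro ⟨k, v, h1, h2⟩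
      exact ⟨(k, v, s), h1, h2, rfl⟩
  have hgc : Computable₂ g := by
    have h1 : Primrec fun y : (BinString × ℕ × ℕ × BinString) × ℕ × List BinString =>
        if natBits y.1.1.length y.1.2.2.1 = y.1.1 ∧ y.1.2.2.1 < 2 ^ y.1.1.length ∧
          y.1.2.2.1 ≤ 2 ^ y.1.1.length * y.2.1 / 2 ^ y.1.2.1 + 1 ∧
          y.1.2.2.2.length + 1 = y.1.1.length ∧ y.1.2.2.2 ∉ y.2.2 then some y.1.2.2.2 else none := by
      have ha : Primrec fun y : (BinString × ℕ × ℕ × BinString) × ℕ × List BinString => y.1.1 :=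
        Primrec.fst.comp Primrec.fst
      have hal := Primrec.list_length.comp ha
      have hx : Primrec fun y : (BinString × ℕ × ℕ × BinString) × ℕ × List BinString => y.1.2 :=
        Primrec.snd.comp Primrec.fst
      have hv := Primrec.fst.comp (Primrec.snd.comp hx)
      have hs := Primrec.snd.comp (Primrec.snd.comp hx)
      have hp := primrec_nat_pow.comp (Primrec.const 2) hal
      have hN : Primrec fun y : (BinString × ℕ × ℕ × BinString) × ℕ × List BinString => y.2.1 :=
        Primrec.fst.comp Primrec.snd
      refine Primrec.ite (PrimrecPred.and (Primrec.eq.comp (primrec_natBits.comp hal hv) ha)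
        (PrimrecPred.and (Primrec.nat_lt.comp hv hp) (PrimrecPred.and
          (Primrec.nat_le.comp hv (Primrec.succ.comp (Primrec.nat_div.comp
            (Primrec.nat_mul.comp hp hN)
            (primrec_nat_pow.comp (Primrec.const 2) (Primrec.fst.comp hx)))))
          (PrimrecPred.and (Primrec.eq.comp (Primrec.succ.comp (Primrec.list_length.comp hs)) hal)
            (PrimrecPred.not (primrecRel_mem_list.comp hs (Primrec.snd.comp Primrec.snd)))))))
        (Primrec.option_some.comp hs) (Primrec.const none)
    have h2 : Computable fun y : (BinString × ℕ) × ℕ × ℕ × BinString =>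
        (((y.1.1, y.2) : BinString × ℕ × ℕ × BinString),
          ((partialNum e List.length y.2.1, enumSeen e y.2.1) : ℕ × List BinString)) :=
      Computable.pair (Computable.pair (Computable.fst.comp Computable.fst) Computable.snd)
        (Computable.pair ((computable_partialNum he Primrec.list_length).comp
          (Computable.fst.comp Computable.snd))
          ((computable_enumSeen he).comp (Computable.fst.comp Computable.snd)))
    rw [hg]
    exact Computable.option_bind (Computable.decode.comp Computable.snd) (h1.to_comp.comp h2).to₂
  refine ⟨fun a => Nat.rfindOpt (g a), Partrec.rfindOpt hgc, fun a s hs => ?_,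
    fun a k v s h1 h2 h3 h4 h5 => Nat.rfindOpt_dom.2 ⟨Encodable.encode (k, v, s), s,
      (hgs _ _ _).2 ⟨k, v, Encodable.encodek _, h1, h2, h3, h4, h5⟩⟩⟩
  obtain ⟨j, hj⟩ := Nat.rfindOpt_spec hs
  obtain ⟨k, v, -, h⟩ := (hgs _ _ _).1 hj
  exact ⟨k, v, h⟩

theorem isWeaklyChaitinRandom_compressibleSum {U V : BinString →. BinString}
    (hU : IsPrefixFreeMachine U) (hV : IsOptimalMachine V) {T : ℝ}
    (hT : IsLeftComputable T) (hT1 : T ≤ 1) :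
    IsWeaklyChaitinRandom U T (compressibleSum V T).toReal := by
  obtain ⟨e, he⟩ := exists_enumeration_compressibleSet hV.1.1 hT
  have hfin : compressibleSum V T ≠ ⊤ :=
    ne_top_of_le_ne_top (by simp) (compressibleSum_le_half hV.1 hT1)
  obtain ⟨G, hGc, hGs, hGd⟩ := exists_partrec_new_string he.computable
  have hC : IsPrefixFreeMachine fun p => (U p).bind G :=
    ⟨hU.1.bind (hGc.comp Computable.snd).to₂, hU.2.mono fun p hp => hp.1⟩
  obtain ⟨d, hd⟩ := hV.exists_program hC
  -- The extra `1` pays for passing from length `n` to `n - 1`, which costs `T ≤ 1`.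
  refine ⟨d + 1, fun n hn => le_programSizeE_iff.2 fun p hp => ?_⟩
  have hf := fract_compressibleSum hV.1 hT1
  have hbp := binPrefix_eq_natBits (compressibleSum V T).toReal n
  rw [hf] at hbp
  have hα := (Int.fract_eq_self.1 hf).2
  have hα0 : 0 ≤ (compressibleSum V T).toReal := ENNReal.toReal_nonneg
  obtain ⟨w, hw⟩ : ∃ w, w = ⌊2 ^ n * (compressibleSum V T).toReal⌋₊ := ⟨_, rfl⟩
  rw [← hw] at hbp
  have hw2 : w < 2 ^ n := by
    rw [hw, Nat.floor_lt (by positivity)]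
    push_cast
    nlinarith [show (0 : ℝ) < 2 ^ n by positivity]
  have hlen : (binPrefix (compressibleSum V T).toReal n).length = n := by simp [binPrefix]
  have hdom : (G (binPrefix (compressibleSum V T).toReal n)).Dom := by
    obtain ⟨k, hk⟩ := he.exists_natFloor_le hfin n
    rw [he.natFloor_partialSum, ← compressibleSum_eq, ← hw] at hk
    obtain ⟨s, hs, hsS⟩ := exists_notMem_compressibleSet hV.1 hT1 (n - 1)
    refine hGd _ k w s ?_ ?_ ?_ ?_ ?_
    · rw [hlen, hbp]
    · rwa [hlen]
    · rwa [hlen]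
    · rw [hlen]
      omega
    · rw [mem_enumSeen]
      rintro ⟨i, -, hi⟩
      exact hsS ((he.mem_iff s).2 ⟨i, hi⟩)
  obtain ⟨s, hs⟩ := Part.dom_iff_mem.1 hdom
  obtain ⟨k, v, hva, hv2, hvk, hsl, hsk⟩ := hGs _ _ hs
  rw [hlen] at hva hv2 hvk hsl
  obtain rfl : v = w := natBits_injOn hv2 hw2 (hva.trans hbp)
  -- The search only ensures that `s` is absent at stage `k`. Two roundings leave an error below `2
  -- * 2 ^ (-n)`, the weight of a string of length `n - 1`, so `s` never appears later.
  have hsS : s ∉ compressibleSet V T := by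
    intro hsS
    refine hsk (he.mem_enumSeen_of_lt hfin (m := n - 1) ?_ hsS (by omega))
    rw [← compressibleSum_eq]
    rw [← he.natFloor_partialSum] at hvk
    have h1 := Nat.lt_floor_add_one (2 ^ n * (compressibleSum V T).toReal)
    rw [← hw] at h1
    have h2 := Nat.floor_le (a := 2 ^ n * partialSum e List.length k)
      (mul_nonneg (by positivity) (partialSum_nonneg _ _ _))
    have h3 : (v : ℝ) ≤ ⌊2 ^ n * partialSum e List.length k⌋₊ + 1 := by exact_mod_cast hvk
    have h4 : (2 : ℝ) ^ n * 2⁻¹ ^ (n - 1) = 2 := by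
      obtain ⟨m, rfl⟩ : ∃ m, n = m + 1 := ⟨n - 1, by omega⟩
      rw [Nat.add_sub_cancel, pow_succ', mul_assoc, ← mul_pow, mul_inv_cancel₀ two_ne_zero,
        one_pow, mul_one]
    have h5 : (2 : ℝ) ^ n * (compressibleSum V T).toReal <
        2 ^ n * (partialSum e List.length k + 2⁻¹ ^ (n - 1)) := by
      rw [mul_add, h4]
      linarith
    exact lt_of_mul_lt_mul_left h5 (by positivity)
  obtain ⟨q, hq, hql⟩ := hd p s (Part.mem_bind hp hs)
  have hTq : T * s.length ≤ q.length := by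
    by_contra hlt
    exact hsS (mem_compressibleSet.2 ⟨q, hq, not_le.1 hlt⟩)
  have hql' : (q.length : ℝ) ≤ p.length + d := by exact_mod_cast hql
  have hsl' : (s.length : ℝ) = n - 1 := by
    rw [← hsl]
    push_cast
    ring
  rw [hsl'] at hTq
  push_cast
  linarith

/-! ### Compressibility -/

theorem IsComputableReal.isLeftComputable {T : ℝ} (hT0 : 0 < T) (hT : IsComputableReal T) :
    IsLeftComputable T := by
  obtain ⟨f, ⟨a, b, ha, hb, hf⟩, hlt⟩ := hT
  -- The numerator of `max(0, f (n + 1) - 1 / (n + 1))`; cutting off at `0` keeps a lower bound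
  -- because `0 < T`.
  obtain ⟨g, hg⟩ : ∃ g : ℕ → ℕ, g = fun n => (a (n + 1)).toNat * (n + 1) - b (n + 1) := ⟨_, rfl⟩
  have hgc : Computable g := by
    have h1 : Computable fun n => b (n + 1) := hb.comp Computable.succ
    have h2 : Computable fun n => (a (n + 1)).toNat :=
      primrec_int_toNat.to_comp.comp (ha.comp Computable.succ)
    rw [hg]
    exact Primrec.nat_sub.to_comp.comp (Primrec.nat_mul.to_comp.comp h2 Computable.succ) h1
  have hdc : Computable fun n => b (n + 1) * (n + 1) :=
    Primrec.nat_mul.to_comp.comp (hb.comp Computable.succ) Computable.succ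
  have key : ∀ n : ℕ, (g n : ℝ) / (b (n + 1) * (n + 1) : ℕ) ≤ T ∧
      T - 2 / (n + 1 : ℝ) ≤ (g n : ℝ) / (b (n + 1) * (n + 1) : ℕ) := by
    intro n
    obtain ⟨hb0, hfn⟩ := hf (n + 1)
    have hb1 : (0 : ℝ) < b (n + 1) := by exact_mod_cast Nat.pos_of_ne_zero hb0
    have hn : (0 : ℝ) < n + 1 := by positivity
    have h1 := hlt (n + 1) (by omega)
    rw [hfn, abs_lt] at h1
    push_cast at h1
    push_cast
    obtain ⟨h1, h2⟩ := h1
    have ht : (a (n + 1) : ℝ) ≤ ((a (n + 1)).toNat : ℝ) := by exact_mod_cast Int.self_le_toNat _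
    constructor
    · rw [div_le_iff₀ (by positivity), hg]
      dsimp only
      rcases le_total ((a (n + 1)).toNat * (n + 1)) (b (n + 1)) with h | h
      · rw [Nat.sub_eq_zero_of_le h]
        push_cast
        positivity
      · have ha0 : 0 ≤ a (n + 1) := by
          by_contra hneg
          rw [Int.toNat_of_nonpos (by omega)] at h
          omega
        have ha1 : ((a (n + 1)).toNat : ℝ) = a (n + 1) := by
          exact_mod_cast Int.toNat_of_nonneg ha0
        rw [Nat.cast_sub h]
        push_cast
        rw [ha1]
        have h3 : (a (n + 1) : ℝ) / b (n + 1) < T + 1 / (n + 1) := by linarith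
        rw [div_lt_iff₀ hb1] at h3
        have h4 : (a (n + 1) : ℝ) * (n + 1) ≤ (T + 1 / (n + 1)) * b (n + 1) * (n + 1) := by
          gcongr
        have h5 : (T + 1 / (n + 1)) * b (n + 1) * (n + 1) =
            T * (b (n + 1) * (n + 1)) + b (n + 1) := by
          field_simp
        linarith
    · rw [le_div_iff₀ (by positivity)]
      have h3 : T - 1 / (n + 1) < (a (n + 1) : ℝ) / b (n + 1) := by linarith
      rw [lt_div_iff₀ hb1] at h3
      have h4 : (T - 1 / (n + 1)) * b (n + 1) * (n + 1) ≤ (a (n + 1)).toNat * (n + 1) := by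
        gcongr
        exact h3.le.trans ht
      have h5 : ((a (n + 1)).toNat * (n + 1) : ℝ) ≤ g n + b (n + 1) := by
        have : (a (n + 1)).toNat * (n + 1) ≤ g n + b (n + 1) := by
          rw [hg]
          exact le_tsub_add
        exact_mod_cast this
      have h6 : (T - 2 / (n + 1)) * (b (n + 1) * (n + 1)) =
          (T - 1 / (n + 1)) * b (n + 1) * (n + 1) - b (n + 1) := by
        field_simp
        ring
      linarith
  have hR : ∀ n, (((-(g n : ℤ) : ℤ) / (b (n + 1) * (n + 1) : ℕ) : ℚ) : ℝ) =
      -((g n : ℝ) / (b (n + 1) * (n + 1) : ℕ)) := fun n => by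
    push_cast
    rw [neg_div]
  refine ⟨fun n => ((-(g n : ℤ) : ℤ) / (b (n + 1) * (n + 1) : ℕ) : ℚ),
    ⟨fun n => -(g n : ℤ), fun n => b (n + 1) * (n + 1), primrec_neg_natCast.to_comp.comp hgc, hdc,
      fun n => ⟨Nat.mul_ne_zero (hf _).1 (Nat.succ_ne_zero n), rfl⟩⟩, fun n _ => ?_, ?_⟩
  · rw [hR]
    exact neg_le_neg (key n).1
  · simp_rw [hR]
    refine Filter.Tendsto.neg (tendsto_of_tendsto_of_tendsto_of_le_of_le ?_ tendsto_const_nhds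
      (fun n => (key n).2) fun n => (key n).1)
    have := (tendsto_one_div_add_atTop_nhds_zero_nat (𝕜 := ℝ)).const_mul 2
    simpa [div_eq_mul_inv] using this.const_sub T

theorem IsComputableReal.exists_nat_approx {T : ℝ} (hT0 : 0 < T) (hT : IsComputableReal T) :
    ∃ t : ℕ → ℕ, Computable t ∧ ∀ n : ℕ, T * n ≤ t n + 2 ∧ (t n : ℝ) ≤ T * n + 1 := by
  obtain ⟨f, ⟨a, b, ha, hb, hf⟩, hlt⟩ := hT
  -- The error `1 / n` of `f n` becomes `1` after scaling by `n`; rounding down loses at most one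
  -- more.
  refine ⟨fun n => (a n).toNat * n / b n, Primrec.nat_div.to_comp.comp
    (Primrec.nat_mul.to_comp.comp (primrec_int_toNat.to_comp.comp ha) Computable.id) hb,
    fun n => ?_⟩
  rcases Nat.eq_zero_or_pos n with rfl | hn
  · simp
  obtain ⟨hb0, hfn⟩ := hf n
  have hb1 : (0 : ℝ) < b n := by exact_mod_cast Nat.pos_of_ne_zero hb0
  have hn0 : (0 : ℝ) < n := by exact_mod_cast hn
  have h1 := hlt n hn
  rw [hfn, abs_lt] at h1
  push_cast at h1
  obtain ⟨h1, h2⟩ := h1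
  rw [lt_div_iff₀ hn0] at h2
  rw [← neg_div, div_lt_iff₀ hn0] at h1
  have ht : (a n : ℝ) ≤ ((a n).toNat : ℝ) := by exact_mod_cast Int.self_le_toNat _
  constructor
  · have h3 : (((a n).toNat * n : ℕ) : ℝ) / b n < ((a n).toNat * n / b n : ℕ) + 1 := by
      rw [← Nat.floor_div_eq_div (K := ℝ)]
      exact Nat.lt_floor_add_one _
    have h4 : (a n : ℝ) / b n * n ≤ (((a n).toNat * n : ℕ) : ℝ) / b n := by
      push_cast
      rw [div_mul_eq_mul_div]
      gcongr
    linarith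
  · rcases le_or_gt 0 (a n) with ha0 | ha0
    · have h3 : (((a n).toNat * n / b n : ℕ) : ℝ) ≤ (((a n).toNat * n : ℕ) : ℝ) / b n :=
        Nat.cast_div_le
      have ha1 : ((a n).toNat : ℝ) = a n := by exact_mod_cast Int.toNat_of_nonneg ha0
      rw [Nat.cast_mul, ha1, mul_div_right_comm] at h3
      linarith
    · dsimp only
      rw [Int.toNat_of_nonpos ha0.le]
      simp only [zero_mul, Nat.zero_div, Nat.cast_zero]
      positivity

/-- Split at `n = L`: upwards the terms decay with ratio `q`, downwards with ratio `1 / (2q)`. For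
`q = 2 ^ (-T)` both ratios are below `1` exactly when `0 < T < 1`. -/
theorem ENNReal.tsum_pow_mul_half_pow_sub_le {q : ℝ≥0∞} (hq : q ≠ 0) (hq' : q ≠ ⊤) (L : ℕ) :
    ∑' n : ℕ, q ^ n * 2⁻¹ ^ (L - n) ≤ q ^ L * ((1 - q)⁻¹ + (1 - q⁻¹ * 2⁻¹)⁻¹) := by
  rw [← ENNReal.summable.sum_add_tsum_nat_add' (k := L), add_comm, mul_add]
  refine add_le_add ?_ ?_
  · rw [← ENNReal.tsum_geometric, ← ENNReal.tsum_mul_left]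
    refine ENNReal.tsum_le_tsum fun n => ?_
    simp [pow_add, mul_comm]
  · rw [← ENNReal.tsum_geometric]
    have h : ∀ n ∈ Finset.range L,
        q ^ n * 2⁻¹ ^ (L - n) = q ^ L * (q⁻¹ * 2⁻¹) ^ (L - 1 - n + 1) := by
      intro n hn
      rw [Finset.mem_range] at hn
      obtain ⟨d, rfl⟩ : ∃ d, L = n + d + 1 := ⟨L - n - 1, by omega⟩
      rw [show n + d + 1 - n = d + 1 by omega, show n + d + 1 - 1 - n = d by omega, mul_pow,
        ← mul_assoc, add_assoc, pow_add q, mul_assoc (q ^ n), ← mul_pow,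
        ENNReal.mul_inv_cancel hq hq', one_pow, mul_one]
    rw [Finset.sum_congr rfl h, ← Finset.mul_sum]
    refine mul_le_mul' le_rfl ?_
    rw [Finset.sum_range_reflect (fun n => (q⁻¹ * 2⁻¹) ^ (n + 1)) L]
    exact (ENNReal.sum_le_tsum _).trans
      (ENNReal.tsum_comp_le_tsum_of_injective (add_left_injective 1) fun n => (q⁻¹ * 2⁻¹) ^ n)

/-! ### Counting the truncations of the partial sums -/

theorem IsEnumeration.sub_weight {β : Type*} [Primcodable β] {e : ℕ → Option β} {ℓ : β → ℕ}
    {S : Set β} (h : IsEnumeration e ℓ S) (n : ℕ) : IsEnumeration e (fun b => ℓ b - n) S where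
  computable := h.computable
  le_index i b hb := (Nat.sub_le _ _).trans (h.le_index i b hb)
  injective := h.injective
  mem_iff := h.mem_iff

/-- With truncated weights an element of weight `ℓ b ≤ n` counts `1`, while it adds an integer to
the scaled sum; any other element adds the same to both. The two sums thus differ by an integer, and
a stage creates a new floor only when the floor of the truncated sum rises. The second conjunct
carries the induction. -/
theorem card_image_natFloor_le {β : Type*} (e : ℕ → Option β) (ℓ : β → ℕ) (n K : ℕ) :
    ((Finset.range (K + 1)).image fun k => ⌊2 ^ n * partialSum e ℓ k⌋₊).card ≤
        1 + ⌊partialSum e (fun b => ℓ b - n) K⌋₊ ∧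
      ∃ m : ℕ, 2 ^ n * partialSum e ℓ K = partialSum e (fun b => ℓ b - n) K + m := by
  induction K with
  | zero => exact ⟨by simp [partialSum], 0, by simp [partialSum]⟩
  | succ K ih =>
    obtain ⟨hcard, m, hm⟩ := ih
    have hy0 := partialSum_nonneg e (fun b => ℓ b - n) K
    have hy0' := partialSum_nonneg e (fun b => ℓ b - n) (K + 1)
    have hmono : partialSum e (fun b => ℓ b - n) K ≤ partialSum e (fun b => ℓ b - n) (K + 1) :=
      partialSum_mono _ _ (Nat.le_succ K)
    have hstep : ∃ m' : ℕ, 2 ^ n * partialSum e ℓ (K + 1) =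
        partialSum e (fun b => ℓ b - n) (K + 1) + m' ∧
        (m' = m ∨ partialSum e (fun b => ℓ b - n) (K + 1) =
          partialSum e (fun b => ℓ b - n) K + 1) := by
      rw [partialSum.eq_1 e ℓ, partialSum.eq_1 e (fun b => ℓ b - n) (K + 1),
        Finset.sum_range_succ, Finset.sum_range_succ, ← partialSum, ← partialSum, mul_add, hm]
      simp only [stageWeight]
      cases hb : e K with
      | none => exact ⟨m, by simp, Or.inl rfl⟩
      | some b =>
        simp only [Option.elim_some]
        rcases le_total (ℓ b) n with hl | hl
        · refine ⟨m + (2 ^ (n - ℓ b) - 1), ?_, Or.inr (by simp [hl])⟩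
          obtain ⟨d, rfl⟩ := Nat.exists_eq_add_of_le hl
          have hd : (2 : ℝ) ^ (ℓ b + d) * 2⁻¹ ^ ℓ b = 2 ^ d := by
            rw [pow_add, mul_right_comm, ← mul_pow, mul_inv_cancel₀ two_ne_zero, one_pow, one_mul]
          rw [hd, Nat.sub_eq_zero_of_le hl, Nat.add_sub_cancel_left, Nat.cast_add,
            Nat.cast_sub Nat.one_le_two_pow]
          push_cast
          ring
        · refine ⟨m, ?_, Or.inl rfl⟩
          obtain ⟨d, hd⟩ := Nat.exists_eq_add_of_le hl
          rw [hd, Nat.add_sub_cancel_left, pow_add, ← mul_assoc, ← mul_pow,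
            mul_inv_cancel₀ two_ne_zero, one_pow, one_mul]
          ring
    obtain ⟨m', hm', hor⟩ := hstep
    refine ⟨?_, m', hm'⟩
    rw [Finset.range_add_one, Finset.image_insert]
    rcases lt_or_ge ⌊partialSum e (fun b => ℓ b - n) K⌋₊
      ⌊partialSum e (fun b => ℓ b - n) (K + 1)⌋₊ with hlt | hge
    · exact (Finset.card_insert_le _ _).trans (by omega)
    · have hfl : ⌊partialSum e (fun b => ℓ b - n) (K + 1)⌋₊ =
          ⌊partialSum e (fun b => ℓ b - n) K⌋₊ := le_antisymm hge (Nat.floor_mono hmono)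
      have hmm : m' = m := by
        refine hor.resolve_right fun h1 => ?_
        rw [h1, Nat.floor_add_one hy0] at hfl
        omega
      rw [Finset.insert_eq_of_mem, hfl]
      · exact hcard
      · refine Finset.mem_image.2 ⟨K, by simp, ?_⟩
        rw [hm, hm', hmm, Nat.floor_add_natCast hy0, Nat.floor_add_natCast hy0', hfl]

/-- The number of values taken by the integer parts of the scaled partial sums. -/
theorem IsEnumeration.tsum_range_natFloor_le {β : Type*} [Primcodable β] {e : ℕ → Option β}
    {ℓ : β → ℕ} {S : Set β} (h : IsEnumeration e ℓ S) (n : ℕ) :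
    ∑' _ : Set.range fun k => ⌊2 ^ n * partialSum e ℓ k⌋₊, (1 : ℝ≥0∞) ≤
      1 + ∑' b : S, (2 : ℝ≥0∞)⁻¹ ^ (ℓ b - n) := by
  rw [ENNReal.tsum_eq_iSup_sum]
  refine iSup_le fun F => ?_
  choose g hg using fun v : Set.range fun k => ⌊2 ^ n * partialSum e ℓ k⌋₊ => v.2
  have hcard : F.card ≤ 1 + ⌊partialSum e (fun b => ℓ b - n) (F.sup g)⌋₊ := by
    refine le_trans ?_ (card_image_natFloor_le e ℓ n (F.sup g)).1
    rw [← Finset.card_image_of_injective F Subtype.val_injective]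
    refine Finset.card_le_card fun v hv => ?_
    obtain ⟨w, hw, rfl⟩ := Finset.mem_image.1 hv
    exact Finset.mem_image.2 ⟨g w, Finset.mem_range.2 (Nat.lt_succ_of_le (Finset.le_sup hw)), hg w⟩
  rw [Finset.sum_const, nsmul_eq_mul, mul_one]
  calc (F.card : ℝ≥0∞) ≤ 1 + (⌊partialSum e (fun b => ℓ b - n) (F.sup g)⌋₊ : ℝ≥0∞) := by
        exact_mod_cast hcard
    _ ≤ 1 + ENNReal.ofReal (partialSum e (fun b => ℓ b - n) (F.sup g)) := by
        refine add_le_add le_rfl ?_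
        rw [← ENNReal.ofReal_natCast]
        exact ENNReal.ofReal_le_ofReal (Nat.floor_le (partialSum_nonneg _ _ _))
    _ ≤ _ := by
        refine add_le_add le_rfl ?_
        rw [partialSum, ENNReal.ofReal_sum_of_nonneg fun i _ => stageWeight_nonneg _ _ i,
          ← (h.sub_weight n).tsum_eq]
        exact ENNReal.sum_le_tsum _

theorem ENNReal.half_pow_eq_ofReal (k : ℕ) :
    (2 : ℝ≥0∞)⁻¹ ^ k = ENNReal.ofReal ((2 : ℝ) ^ (-(k : ℝ))) := by
  rw [Real.rpow_neg two_pos.le, Real.rpow_natCast, ENNReal.ofReal_inv_of_pos (by positivity),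
    ENNReal.ofReal_pow two_pos.le, ENNReal.ofReal_ofNat, ENNReal.inv_pow]

theorem ENNReal.ofReal_two_rpow_neg_pow (T : ℝ) (n : ℕ) :
    ENNReal.ofReal ((2 : ℝ) ^ (-T)) ^ n = ENNReal.ofReal ((2 : ℝ) ^ (-(T * n))) := by
  rw [← ENNReal.ofReal_pow (by positivity), ← Real.rpow_natCast, ← Real.rpow_mul two_pos.le,
    neg_mul]

/-- Up to a factor, the total weight of the requests made for compressibility: the sums are
exchanged, and `∑ q ^ |s| ≤ 1` by Kraft's inequality, as `q = 2 ^ (-T)`. -/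
theorem tsum_compressibleSet_approx_ne_top {V : BinString →. BinString}
    (hV : IsPrefixFreeMachine V) {T : ℝ} (hT0 : 0 < T) (hT1 : T < 1) {t : ℕ → ℕ}
    (ht : ∀ n : ℕ, T * n ≤ t n + 2) :
    ∑' n : ℕ, (2 : ℝ≥0∞)⁻¹ ^ t n *
      (1 + ∑' s : compressibleSet V T, (2 : ℝ≥0∞)⁻¹ ^ (s.1.length - n)) ≠ ⊤ := by
  obtain ⟨q, hq⟩ : ∃ q, q = ENNReal.ofReal ((2 : ℝ) ^ (-T)) := ⟨_, rfl⟩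
  have hq0 : q ≠ 0 := by
    rw [hq]
    exact (ENNReal.ofReal_pos.2 (by positivity)).ne'
  have hqt : q ≠ ⊤ := hq ▸ ENNReal.ofReal_ne_top
  have hq1 : q < 1 := by
    rw [hq, ENNReal.ofReal_lt_one]
    exact Real.rpow_lt_one_of_one_lt_of_neg one_lt_two (by linarith)
  have hq2 : q⁻¹ * 2⁻¹ < 1 := by
    rw [← ENNReal.mul_inv (Or.inl hq0) (Or.inl hqt), ENNReal.inv_lt_one, hq,
      ← ENNReal.ofReal_ofNat, ← ENNReal.ofReal_mul (by positivity), ENNReal.one_lt_ofReal]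
    calc (1 : ℝ) = 2 ^ (-1 : ℝ) * 2 := by rw [Real.rpow_neg_one]; norm_num
      _ < 2 ^ (-T) * 2 := by
        exact mul_lt_mul_of_pos_right
          (Real.rpow_lt_rpow_of_exponent_lt one_lt_two (neg_lt_neg hT1)) two_pos
  -- `4 = 2 ^ 2` absorbs the error `2` in `ht`.
  have hqt' : ∀ n, (2 : ℝ≥0∞)⁻¹ ^ t n ≤ 4 * q ^ n := by
    intro n
    have h4 : (4 : ℝ≥0∞) = ENNReal.ofReal ((2 : ℝ) ^ (2 : ℝ)) := by
      norm_num
    rw [hq, ENNReal.ofReal_two_rpow_neg_pow, ENNReal.half_pow_eq_ofReal, h4,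
      ← ENNReal.ofReal_mul (by positivity), ← Real.rpow_add two_pos]
    refine ENNReal.ofReal_le_ofReal (Real.rpow_le_rpow_of_exponent_le one_le_two ?_)
    linarith [ht n]
  have hsum : ∑' s : compressibleSet V T, q ^ s.1.length ≤ 1 := by
    refine tsum_compressibleSet_le_one hV (w := fun s => q ^ s.length) fun s k hk => ?_
    rw [hq, ENNReal.ofReal_two_rpow_neg_pow, ENNReal.half_pow_eq_ofReal]
    exact ENNReal.ofReal_le_ofReal (Real.rpow_le_rpow_of_exponent_le one_le_two (by linarith))
  have hC : (1 - q)⁻¹ + (1 - q⁻¹ * 2⁻¹)⁻¹ ≠ ⊤ :=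
    ENNReal.add_ne_top.2 ⟨ENNReal.inv_ne_top.2 (tsub_pos_of_lt hq1).ne',
      ENNReal.inv_ne_top.2 (tsub_pos_of_lt hq2).ne'⟩
  have hle : ∑' n : ℕ, q ^ n *
      (1 + ∑' s : compressibleSet V T, (2 : ℝ≥0∞)⁻¹ ^ (s.1.length - n)) ≤
      (1 - q)⁻¹ + ((1 - q)⁻¹ + (1 - q⁻¹ * 2⁻¹)⁻¹) := by
    simp_rw [mul_add, mul_one]
    rw [ENNReal.tsum_add, ENNReal.tsum_geometric]
    refine add_le_add le_rfl ?_
    simp_rw [← ENNReal.tsum_mul_left]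
    rw [ENNReal.tsum_comm]
    calc ∑' (s : compressibleSet V T) (n : ℕ), q ^ n * 2⁻¹ ^ (s.1.length - n)
        ≤ ∑' s : compressibleSet V T, q ^ s.1.length * ((1 - q)⁻¹ + (1 - q⁻¹ * 2⁻¹)⁻¹) :=
          ENNReal.tsum_le_tsum fun s => ENNReal.tsum_pow_mul_half_pow_sub_le hq0 hqt _
      _ ≤ 1 * ((1 - q)⁻¹ + (1 - q⁻¹ * 2⁻¹)⁻¹) := by
          rw [ENNReal.tsum_mul_right]
          exact mul_le_mul' hsum le_rfl
      _ = _ := one_mul _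
  refine ne_top_of_le_ne_top (ENNReal.mul_ne_top (a := 4) (by simp) (ne_top_of_le_ne_top
    (ENNReal.add_ne_top.2 ⟨ENNReal.inv_ne_top.2 (tsub_pos_of_lt hq1).ne', hC⟩) hle)) ?_
  rw [← ENNReal.tsum_mul_left]
  refine ENNReal.tsum_le_tsum fun n => ?_
  rw [← mul_assoc]
  exact mul_le_mul' (hqt' n) le_rfl

theorem isStrictlyCompressible_compressibleSum {U V : BinString →. BinString}
    (hU : IsOptimalMachine U) (hV : IsPrefixFreeMachine V) {T : ℝ} (hT0 : 0 < T)
    (hT : IsComputableReal T) (hT1 : T < 1) :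
    IsStrictlyCompressible U T (compressibleSum V T).toReal := by
  obtain ⟨e, he⟩ := exists_enumeration_compressibleSet hV.1 (hT.isLeftComputable hT0)
  obtain ⟨t, htc, ht⟩ := hT.exists_nat_approx hT0
  have hfin : compressibleSum V T ≠ ⊤ :=
    ne_top_of_le_ne_top (by simp) (compressibleSum_le_half hV hT1.le)
  -- The Boolean covers the possible deficit of one in the truncated partial sum.
  obtain ⟨φ, hφ⟩ : ∃ φ : ℕ × ℕ × Bool → ℕ × BinString, φ = fun x => (t x.1, natBits x.1
      (2 ^ x.1 * partialNum e List.length x.2.1 / 2 ^ x.2.1 + x.2.2.toNat)) := ⟨_, rfl⟩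
  have hφc : Computable φ := by
    have h1 : Primrec fun y : (ℕ × ℕ × Bool) × ℕ =>
        natBits y.1.1 (2 ^ y.1.1 * y.2 / 2 ^ y.1.2.1 + y.1.2.2.toNat) :=
      primrec_natBits.comp (Primrec.fst.comp Primrec.fst) (Primrec.nat_add.comp
        (Primrec.nat_div.comp (Primrec.nat_mul.comp
          (primrec_nat_pow.comp (Primrec.const 2) (Primrec.fst.comp Primrec.fst)) Primrec.snd)
          (primrec_nat_pow.comp (Primrec.const 2)
            (Primrec.fst.comp (Primrec.snd.comp Primrec.fst))))
        ((Primrec.dom_bool Bool.toNat).comp (Primrec.snd.comp (Primrec.snd.comp Primrec.fst))))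
    have h2 : Computable fun x : ℕ × ℕ × Bool => (x, partialNum e List.length x.2.1) :=
      Computable.pair Computable.id ((computable_partialNum he.computable Primrec.list_length).comp
        (Computable.fst.comp Computable.snd))
    have h3 : Computable fun x : ℕ × ℕ × Bool => natBits x.1
        (2 ^ x.1 * partialNum e List.length x.2.1 / 2 ^ x.2.1 + x.2.2.toNat) := by
      refine (h1.to_comp.comp h2).of_eq fun x => ?_
      dsimp only
    rw [hφ]
    exact Computable.pair (htc.comp Computable.fst) h3
  have hr : Computable fun i : ℕ => (Encodable.decode (α := ℕ × ℕ × Bool) i).map φ :=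
    Computable.option_map Computable.decode (hφc.comp Computable.snd).to₂
  obtain ⟨c, hc⟩ := hU.exists_program_of_requests hr <| by
    refine ne_top_of_le_ne_top (ENNReal.mul_ne_top (a := 2) (by simp)
      (tsum_compressibleSet_approx_ne_top hV hT0 hT1 fun n => (ht n).1)) ?_
    -- Indexing by values of the floor rather than by stages counts a truncation once, however many
    -- stages produce it.
    obtain ⟨ψ, hψ⟩ : ∃ ψ : (Σ n : ℕ, (Set.range fun k => ⌊2 ^ n * partialSum e List.length k⌋₊) ×
        Bool) → {b : ℕ × BinString | ∃ i, (Encodable.decode (α := ℕ × ℕ × Bool) i).map φ = some b},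
        ∀ x, (ψ x).1 = (t x.1, natBits x.1 (x.2.1.1 + x.2.2.toNat)) := by
      refine ⟨fun x => ⟨(t x.1, natBits x.1 (x.2.1.1 + x.2.2.toNat)), ?_⟩, fun x => rfl⟩
      obtain ⟨n, ⟨v, k, hk⟩, b⟩ := x
      refine ⟨Encodable.encode (n, k, b), ?_⟩
      rw [Encodable.encodek, Option.map_some, hφ]
      dsimp only at hk ⊢
      rw [← he.natFloor_partialSum, hk]
    have hsurj : Function.Surjective ψ := by
      rintro ⟨b, i, hi⟩
      obtain ⟨⟨n, k, b'⟩, -, rfl⟩ := Option.map_eq_some_iff.1 hi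
      refine ⟨⟨n, ⟨_, k, rfl⟩, b'⟩, Subtype.ext ?_⟩
      have h : φ (n, k, b') =
          (t n, natBits n (⌊2 ^ n * partialSum e List.length k⌋₊ + b'.toNat)) := by
        rw [hφ, he.natFloor_partialSum]
      exact (hψ _).trans h.symm
    refine (ENNReal.tsum_le_tsum_comp_of_surjective hsurj
      fun b => (2 : ℝ≥0∞)⁻¹ ^ b.1.1).trans ?_
    simp_rw [hψ]
    rw [ENNReal.tsum_sigma', ← ENNReal.tsum_mul_left]
    refine ENNReal.tsum_le_tsum fun n => ?_
    rw [ENNReal.tsum_prod (f := fun _ _ => (2 : ℝ≥0∞)⁻¹ ^ t n)]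
    simp_rw [tsum_fintype, Finset.sum_const, Finset.card_univ, Fintype.card_bool, nsmul_eq_mul]
    rw [ENNReal.tsum_mul_left, Nat.cast_ofNat]
    refine mul_le_mul' le_rfl ?_
    calc ∑' _ : Set.range fun k => ⌊2 ^ n * partialSum e List.length k⌋₊, (2 : ℝ≥0∞)⁻¹ ^ t n
        = 2⁻¹ ^ t n *
          ∑' _ : Set.range fun k => ⌊2 ^ n * partialSum e List.length k⌋₊, (1 : ℝ≥0∞) := by
          rw [← ENNReal.tsum_mul_left, mul_one]
      _ ≤ _ := mul_le_mul' le_rfl (he.tsum_range_natFloor_le n)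
  -- The `1` comes from `t n ≤ T * n + 1`.
  refine ⟨c + 1, fun n _ => ?_⟩
  obtain ⟨k, hk⟩ := he.exists_natFloor_le hfin n
  rw [← compressibleSum_eq] at hk
  have hk' : ⌊2 ^ n * partialSum e List.length k⌋₊ ≤ ⌊2 ^ n * (compressibleSum V T).toReal⌋₊ :=
    Nat.floor_mono (mul_le_mul_of_nonneg_left (he.partialSum_le hfin k) (by positivity))
  obtain ⟨b, hb⟩ : ∃ b : Bool, ⌊2 ^ n * (compressibleSum V T).toReal⌋₊ =
      ⌊2 ^ n * partialSum e List.length k⌋₊ + b.toNat := by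
    rcases Nat.lt_or_ge ⌊2 ^ n * partialSum e List.length k⌋₊
      ⌊2 ^ n * (compressibleSum V T).toReal⌋₊ with h | h
    · exact ⟨true, le_antisymm hk h⟩
    · exact ⟨false, le_antisymm h hk'⟩
  obtain ⟨p, hp, hpl⟩ := hc (Encodable.encode (n, k, b)) (t n)
    (binPrefix (compressibleSum V T).toReal n) (by
      rw [Encodable.encodek, Option.map_some, hφ, binPrefix_eq_natBits,
        fract_compressibleSum hV hT1.le, hb, he.natFloor_partialSum])
  refine programSizeE_le hp ?_
  have hpl' : (p.length : ℝ) ≤ t n + c := by exact_mod_cast hpl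
  push_cast
  linarith [(ht n).2]

theorem mainTheorem5 (U V : BinString →. BinString)
    (hU : IsOptimalMachine U) (hV : IsOptimalMachine V) (T : ℝ) (hT : 0 < T) :
    (IsLeftComputable T → T ≤ 1 →
      compressibleSum V T ≠ ⊤ ∧
      IsLeftComputable (compressibleSum V T).toReal ∧
      IsWeaklyChaitinRandom U T (compressibleSum V T).toReal) ∧
    (IsComputableReal T → T < 1 →
      compressibleSum V T ≠ ⊤ ∧
      IsStrictlyCompressible U T (compressibleSum V T).toReal) ∧
    (1 < T → compressibleSum V T = ⊤) := by
  have hfin : T ≤ 1 → compressibleSum V T ≠ ⊤ := fun hT1 =>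
    ne_top_of_le_ne_top (by simp) (compressibleSum_le_half hV.1 hT1)
  refine ⟨fun hl hT1 => ⟨hfin hT1, ?_, isWeaklyChaitinRandom_compressibleSum hU.1 hV hl hT1⟩,
    fun hc hT1 => ⟨hfin hT1.le, isStrictlyCompressible_compressibleSum hU hV.1 hT hc hT1⟩,
    compressibleSum_eq_top hV⟩
  obtain ⟨e, he⟩ := exists_enumeration_compressibleSet hV.1.1 hl
  exact he.isLeftComputable Primrec.list_length (hfin hT1)
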